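/- Let $n\ge 2$ and let $m\ge 2$ be even. Let $\mathcal G_{n,m}$ be the cylinder graph with vertex set $\mathbb Z/2n\mathbb Z\times\{1,\dots,m\}$ and nearest-neighbour edges, viewed as two copies of the rectangle $[0,n]\times[1,m]\subset\mathbb Z^2$, embedded by $(x,y)\mapsto(x,y)$ and $(x,y)\mapsto(-x,y)$, which are glued along the two vertical sides $\{0\}\times[1,m]$ and $\{n\}\times[1,m]$. Superimposing the two layers of a uniformly random dimer configuration (perfect matching) of $\mathcal G_{n,m}$ gives a random configuration on the rectangle made of disjoint loops, doubled edges and arcs, where each arc is a path (possibly a single edge) linking two vertices of the vertical sides. Let $N_{n,m}$ be the number of arcs that link one vertical side to the other one. Let $\tau>0$ be fixed and $q=e^{-\pi\tau}$. When $n,m\to\infty$ with $m$ even and $n/m\to\tau$, for every $Y\in\mathbb C$, $$\sum_{k\ge 0}\mathbb P[N_{n,m}=k]\,Y^k\;\longrightarrow\;\prod_{\substack{j\ge 1\\ j\text{ odd}}}\frac{1+q^{2j}-2q^{j}+4Y^2q^{j}}{1+q^{2j}+2q^{j}},$$ where the infinite product converges. -/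

import Mathlib

open Filter Topology

noncomputable section

namespace FoldedCylinder

/-- The cylinder `ℤ/2nℤ × [1,m]`, with nearest-neighbour edges. The height `y ∈ [1,m]` is
represented by `y - 1 : Fin m`. -/
def cylinder (n m : ℕ) : SimpleGraph (ZMod (2 * n) × Fin m) :=
  SimpleGraph.boxProd (SimpleGraph.circulantGraph {1}) (SimpleGraph.pathGraph m)

/-- The vertices of the rectangle `[0,n] × [1,m]`. -/
abbrev Rect (n m : ℕ) : Type := Fin (n + 1) × Fin m

/-- The first copy of the rectangle inside the cylinder: `(x, y, 1) = (x, y)`. -/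
def layerOne {n m : ℕ} (p : Rect n m) : ZMod (2 * n) × Fin m :=
  (((p.1 : ℕ) : ZMod (2 * n)), p.2)

/-- The second copy of the rectangle inside the cylinder: `(x, y, 2) = (-x, y)`.
It meets the first copy exactly in the two vertical sides `x = 0` and `x = n`. -/
def layerTwo {n m : ℕ} (p : Rect n m) : ZMod (2 * n) × Fin m :=
  (-((p.1 : ℕ) : ZMod (2 * n)), p.2)

/-- The dimer configurations (perfect matchings) of the cylinder. -/
def dimerConfigs (n m : ℕ) : Set (cylinder n m).Subgraph :=
  {M | M.IsPerfectMatching}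

/-- The folded configuration: the edges of the two layers are superimposed on the rectangle. For `n ≥ 2`, each
vertex off the two vertical sides has degree two, or lies on a doubled edge; each vertex of the
vertical sides has degree one. So the connected components are the loops and the doubled
edges, which avoid the vertical sides, and the arcs (possibly of length one), which are paths whose
two endpoints are the only vertices that they have on the vertical sides. -/
def fold {n m : ℕ} (M : (cylinder n m).Subgraph) : SimpleGraph (Rect n m) :=
  M.spanningCoe.comap layerOne ⊔ M.spanningCoe.comap layerTwo

/-- The arcs that go from one vertical side to the other: the components of the folded
configuration that meet the side `x = 0` and the side `x = n`. -/
def crossingArcs {n m : ℕ} (M : (cylinder n m).Subgraph) : Set (fold M).ConnectedComponent :=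
  {A | (∃ y : Fin m, ((0 : Fin (n + 1)), y) ∈ A.supp) ∧
    ∃ y : Fin m, (Fin.last n, y) ∈ A.supp}

/-- The number of arcs that go from one vertical side to the other. -/
def numCrossing {n m : ℕ} (M : (cylinder n m).Subgraph) : ℕ := (crossingArcs M).ncard

/-- The probability that a uniformly random dimer configuration of the cylinder folds to a
configuration with exactly `k` crossing arcs. -/
def probCrossing (n m k : ℕ) : ℝ :=
  ({M ∈ dimerConfigs n m | numCrossing M = k}.ncard : ℝ) / ((dimerConfigs n m).ncard : ℝ)

/-- The generating function `∑ₖ P[N = k] Yᵏ`. For `n ≥ 1` all but finitely many terms vanish. -/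
def crossingGenFun (n m : ℕ) (Y : ℂ) : ℂ := ∑' k : ℕ, (probCrossing n m k : ℂ) * Y ^ k

/-- The factor `(1 + q^{2j} - 2 q^j + 4 Y² q^j) / (1 + q^{2j} + 2 q^j)`. -/
def limitFactor (q : ℝ) (Y : ℂ) (j : ℕ) : ℂ :=
  (1 + (q : ℂ) ^ (2 * j) - 2 * (q : ℂ) ^ j + 4 * Y ^ 2 * (q : ℂ) ^ j) /
    (1 + (q : ℂ) ^ (2 * j) + 2 * (q : ℂ) ^ j)

end FoldedCylinder

end

/-! Crossing arcs are counted through a signed charge. A vertex of the rectangle gets `flux` its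
bipartite sign times (matched in layer one) minus (matched in layer two). Since an edge joins
opposite signs, the matched vertices of a layer cancel in pairs, so each component of the fold has
total flux zero. Only vertices of the vertical sides have nonzero flux. Hence a component that
misses a side sends nothing through the left side, while a crossing arc sends 1 or -1. Exchanging
the layers over an arc is an involution of the dimer configurations that keeps the fold and reverses
this sign. Averaging over such exchanges gives `sum_pow_numCrossing`: the sum of ((w + w⁻¹)/2)^N
equals the sum of w^flux.

The flux is, up to an affine change (`totalFlux_add`), a conserved particle number. Take the
horizontal dimers crossing a column cut and exchange occupied with empty on the sites with x + y
odd. The matching condition then says that each particle stays or hops along a vertical dimer from a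
source to a neighbouring non-source. Particles keep their order, so the many-particle transfer
matrix of a column is the compound matrix of 1 + `hopMatrix` (`compound_one_add_hopMatrix`). By
Cauchy–Binet and the trace formula for compounds, the partition function with weight z per particle
is det(1 + z T^n), with T the one-particle matrix of two columns
(`sum_dimerConfigs_pow_card_occupied`).

Sine waves diagonalise T, and for even height its eigenvalues form inverse pairs exp(±2 `modeRate`)
(`det_transfer_even`). Putting z = w² and Y = (w + w⁻¹)/2 yields the exact finite product
`crossingGenFun_eq_prod`. Each factor converges because 2n times the rate of mode i tends to πτ(2i +
1), and a linear lower bound on the rates allows dominated convergence of the products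
(`tendsto_prod_modes`). -/

namespace FoldedCylinder
open Finset Matrix

/-! ### Compound matrices: Cauchy–Binet and traces -/

section Compound
variable {R : Type*} [CommRing R]

/-- Expansion of the determinant of a product over all maps. -/
lemma det_mul_eq_sum_submatrix {ι κ : Type*} [Fintype κ] [DecidableEq κ] [Fintype ι]
    [DecidableEq ι] (S : Matrix κ ι R) (T : Matrix ι κ R) :
    (S * T).det = ∑ f : κ → ι, (∏ i, S i (f i)) * (T.submatrix f id).det := by
  have h : (S * T) = fun i => ∑ j, S i j • T j := by
    ext i k; simp [Matrix.mul_apply]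
  change Matrix.detRowAlternating (S * T) = _
  rw [h]
  refine ((Matrix.detRowAlternating (R := R) (n := κ)).toMultilinearMap.map_sum
    (fun i j => S i j • T j)).trans ?_
  refine Finset.sum_congr rfl fun f _ => ?_
  exact (Matrix.detRowAlternating (R := R) (n := κ)).toMultilinearMap.map_smul_univ
    (fun i => S i (f i)) (fun i => T (f i))

variable {m : ℕ}

/-- The compound matrix: all minors of `t`, rows and columns in increasing order. -/
noncomputable def compound (t : Matrix (Fin m) (Fin m) R) :
    Matrix (Finset (Fin m)) (Finset (Fin m)) R := fun A B =>
  if h : B.card = A.card then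
    (t.submatrix (A.orderEmbOfFin rfl) (B.orderEmbOfFin h)).det else 0

lemma compound_eq {k : ℕ} (t : Matrix (Fin m) (Fin m) R) {A B : Finset (Fin m)}
    (hA : A.card = k) (hB : B.card = k) :
    compound t A B = (t.submatrix (A.orderEmbOfFin hA) (B.orderEmbOfFin hB)).det := by
  subst hA
  simp [compound, hB]

lemma compound_of_card_ne (t : Matrix (Fin m) (Fin m) R) {A B : Finset (Fin m)}
    (h : B.card ≠ A.card) : compound t A B = 0 := by simp [compound, h]

/-- A sum over maps `Fin k → Fin m` that only sees injective ones: every injective map is a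
permutation followed by the increasing enumeration of its range. -/
lemma sum_eq_sum_card_sum_perm {k : ℕ} (φ : (Fin k → Fin m) → R)
    (hφ : ∀ f, ¬ Function.Injective f → φ f = 0) :
    ∑ f, φ f = ∑ C : Finset (Fin m), if h : C.card = k then
      ∑ σ : Equiv.Perm (Fin k), φ (fun i => C.orderEmbOfFin h (σ i)) else 0 := by
  classical
  rw [← Finset.sum_fiberwise univ (fun f : Fin k → Fin m => univ.image f) φ]
  refine Finset.sum_congr rfl fun C _ => ?_
  split_ifs with h
  · symm
    refine Finset.sum_of_injOn (fun σ i => C.orderEmbOfFin h (σ i)) ?_ ?_ ?_ ?_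
    · intro σ _ τ _ hst
      ext i
      have := congrFun hst i
      simpa using congrArg Fin.val ((C.orderEmbOfFin h).injective this)
    · intro σ _
      simp only [coe_filter, mem_univ, true_and, Set.mem_ofPred_eq]
      ext y
      rw [← Finset.mem_coe (s := C), ← Finset.range_orderEmbOfFin C h]
      simp only [mem_image, mem_univ, true_and, Set.mem_range]
      exact ⟨fun ⟨i, hi⟩ => ⟨_, hi⟩, fun ⟨i, hi⟩ => ⟨σ.symm i, by simpa using hi⟩⟩
    · intro f hf hnot
      apply hφ
      intro hinj
      apply hnot
      simp only [mem_filter, mem_univ, true_and] at hf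
      have hm : ∀ i, f i ∈ Set.range (C.orderEmbOfFin h) := fun i => by
        rw [Finset.range_orderEmbOfFin, ← hf]; simp
      choose g hg using hm
      have hgi : Function.Injective g := fun i j hij => hinj (by rw [← hg i, ← hg j, hij])
      refine ⟨Equiv.ofBijective g (Finite.injective_iff_bijective.mp hgi), by simp, ?_⟩
      ext i
      simp [hg]
    · intro σ _; rfl
  · refine Finset.sum_eq_zero fun f hf => hφ f fun hinj => h ?_
    simp only [mem_filter, mem_univ, true_and] at hf
    rw [← hf, Finset.card_image_of_injective _ hinj]
    simp

/-- The **Cauchy–Binet formula**: compound matrices are multiplicative. -/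
theorem compound_mul (s t : Matrix (Fin m) (Fin m) R) :
    compound (s * t) = compound s * compound t := by
  ext A B
  rw [Matrix.mul_apply]
  by_cases hB : B.card = A.card
  · rw [compound_eq (s * t) rfl hB, ← Matrix.submatrix_mul_equiv _ _ _ (Equiv.refl (Fin m))]
    rw [det_mul_eq_sum_submatrix, sum_eq_sum_card_sum_perm]
    · refine Finset.sum_congr rfl fun C _ => ?_
      split_ifs with h
      · rw [compound_eq s rfl h, compound_eq t h hB]
        -- Sorting the rows of the minor of t produces the sign of σ, which is the one needed to
        -- assemble the minor of s.
        rw [← Matrix.det_transpose (s.submatrix _ _), Matrix.det_apply', Finset.sum_mul]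
        refine Finset.sum_congr rfl fun σ _ => ?_
        have := Matrix.det_permute σ (t.submatrix (C.orderEmbOfFin h) (B.orderEmbOfFin hB))
        simp only [Matrix.submatrix_submatrix, Function.comp_def] at this ⊢
        simp only [Equiv.coe_refl, id] at this ⊢
        rw [this]
        simp only [submatrix_apply, transpose_apply, id]
        ring
      · rw [compound_of_card_ne s h, zero_mul]
    · intro f hf
      rw [Function.Injective] at hf
      push Not at hf
      obtain ⟨i, j, hij, hne⟩ := hf
      rw [Matrix.det_zero_of_row_eq hne, mul_zero]
      ext l
      simp [hij]
  · rw [compound_of_card_ne _ hB]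
    refine (Finset.sum_eq_zero fun C _ => ?_).symm
    by_cases h : C.card = A.card
    · rw [compound_of_card_ne t (by rwa [h]), mul_zero]
    · rw [compound_of_card_ne s h, zero_mul]

lemma submatrix_orderEmb_one_det {k : ℕ} {A B : Finset (Fin m)} (hA : A.card = k)
    (hB : B.card = k) :
    ((1 : Matrix (Fin m) (Fin m) R).submatrix (A.orderEmbOfFin hA) (B.orderEmbOfFin hB)).det =
      if A = B then 1 else 0 := by
  split_ifs with h
  · subst h
    rw [Matrix.submatrix_one _ (A.orderEmbOfFin hA).injective, Matrix.det_one]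
  · obtain ⟨a, haA, haB⟩ : ∃ a ∈ A, a ∉ B := by
      by_contra! hc
      exact h (Finset.eq_of_subset_of_card_le hc (by omega))
    have : a ∈ Set.range (A.orderEmbOfFin hA) := by
      rw [Finset.range_orderEmbOfFin]; exact haA
    obtain ⟨i, rfl⟩ := this
    refine Matrix.det_eq_zero_of_row_eq_zero i fun j => ?_
    rw [Matrix.submatrix_apply, Matrix.one_apply_ne]
    intro hc
    exact haB (hc ▸ Finset.orderEmbOfFin_mem B hB j)

lemma compound_one : compound (1 : Matrix (Fin m) (Fin m) R) = 1 := by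
  ext A B
  by_cases hB : B.card = A.card
  · rw [compound_eq _ rfl hB, submatrix_orderEmb_one_det, Matrix.one_apply]
  · rw [compound_of_card_ne _ hB, Matrix.one_apply_ne]
    rintro rfl
    exact hB rfl

lemma compound_apply_self (t : Matrix (Fin m) (Fin m) R) (A : Finset (Fin m)) :
    compound t A A = (t.submatrix (Subtype.val : A → Fin m) (Subtype.val : A → Fin m)).det := by
  rw [compound_eq t rfl rfl, ← Matrix.det_submatrix_equiv_self (A.orderIsoOfFin rfl).toEquiv]
  rfl

/-- The generating function of the traces of the compounds. -/
theorem sum_pow_card_mul_compound (t : Matrix (Fin m) (Fin m) R) (z : R) :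
    ∑ A : Finset (Fin m), z ^ A.card * compound t A A = (1 + z • t).det := by
  have h := Matrix.coeff_det_one_add_X_smul_eq_sum_minors t
  set p := (1 + (Polynomial.X : Polynomial R) • t.map Polynomial.C).det with hp
  have hev : p.eval z = (1 + z • t).det := by
    rw [hp, ← Polynomial.coe_evalRingHom, RingHom.map_det]
    congr 1
    ext i j
    rcases eq_or_ne i j with rfl | hij
    · simp [mul_comm z]
    · simp [hij, mul_comm z]
  have hdeg : p.natDegree < m + 1 := by
    refine Nat.lt_succ_of_le (Polynomial.natDegree_le_iff_coeff_eq_zero.mpr fun N hN => ?_)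
    rw [h, Finset.powersetCard_eq_empty.mpr (by simpa using hN), Finset.sum_empty]
  rw [← hev, Polynomial.eval_eq_sum_range' hdeg]
  simp_rw [h, ← compound_apply_self]
  rw [← Finset.sum_fiberwise_of_maps_to (s := univ) (t := range (m + 1)) (g := Finset.card)]
  · refine Finset.sum_congr rfl fun k _ => ?_
    rw [Finset.sum_mul]
    refine Finset.sum_congr (by ext; simp [mem_powersetCard]) fun A hA => ?_
    simp only [mem_powersetCard] at hA
    rw [hA.2, mul_comm]
  · intro A _
    simpa [Nat.lt_succ_iff] using Finset.card_le_univ A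

end Compound

/-! ### A single hop as the compound of an elementary matrix -/

section Hop
variable {R : Type*} [CommRing R] {m : ℕ}

lemma insert_erase_eq_iff {α : Type*} [DecidableEq α] {i j : α} {A B : Finset α} (hi : i ∈ A)
    (hj : j ∉ A) : insert j (A.erase i) = B ↔ j ∈ B ∧ i ∉ B ∧ A = insert i (B.erase j) := by
  have hij : i ≠ j := by rintro rfl; exact hj hi
  constructor
  · rintro rfl
    refine ⟨by simp, by simp [hij], ?_⟩
    rw [Finset.erase_insert (by simp [hj]), Finset.insert_erase hi]
  · rintro ⟨hjB, hiB, rfl⟩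
    rw [Finset.erase_insert (by simp [hiB]), Finset.insert_erase hjB]

/-- The compound of an elementary matrix at two neighbouring indices: a particle may hop. -/
theorem compound_one_add_single {i j : Fin m} (hij : i.val + 1 = j.val ∨ j.val + 1 = i.val)
    (A B : Finset (Fin m)) :
    compound (1 + Matrix.single i j (1 : R)) A B =
      (if A = B then 1 else 0) +
        if j ∈ B ∧ i ∉ B ∧ A = insert i (B.erase j) then 1 else 0 := by
  have hne : i ≠ j := by rintro rfl; omega
  by_cases hB : B.card = A.card
  swap
  · rw [compound_of_card_ne _ hB, if_neg (by rintro rfl; exact hB rfl), if_neg, add_zero]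
    rintro ⟨h1, h2, rfl⟩
    apply hB
    rw [Finset.card_insert_of_notMem (by simp [h2]), Finset.card_erase_add_one h1]
  rw [compound_eq _ rfl hB, ← submatrix_orderEmb_one_det (R := R) rfl hB]
  set a := A.orderEmbOfFin rfl with ha
  set b := B.orderEmbOfFin hB with hb
  by_cases hi : i ∈ A
  · obtain ⟨r, hr⟩ : i ∈ Set.range a := by rw [ha, Finset.range_orderEmbOfFin]; exact hi
    have hM : (1 + Matrix.single i j (1 : R)).submatrix a b =
        ((1 : Matrix (Fin m) (Fin m) R).submatrix a b).updateRow r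
          ((1 : Matrix (Fin m) (Fin m) R).submatrix a b r +
            fun l => (1 : Matrix (Fin m) (Fin m) R) j (b l)) := by
      ext p q
      by_cases hp : p = r
      · subst hp
        simp [hr, Matrix.single_apply, Matrix.one_apply]
      · have : i ≠ a p := fun h => hp (a.injective (h.symm.trans hr.symm))
        simp [hp, this]
    rw [hM, Matrix.det_updateRow_add, Matrix.updateRow_eq_self]
    congr 1
    have hM' : ((1 : Matrix (Fin m) (Fin m) R).submatrix a b).updateRow r
        (fun l => (1 : Matrix (Fin m) (Fin m) R) j (b l)) =
        (1 : Matrix (Fin m) (Fin m) R).submatrix (Function.update (a : Fin A.card → Fin m) r j) b := by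
      ext p q
      by_cases hp : p = r
      · subst hp
        simp only [updateRow_self, submatrix_apply]
        rw [Function.update_self]
      · rw [updateRow_ne hp, submatrix_apply, submatrix_apply, Function.update_of_ne hp]
    rw [hM']
    -- If j is already occupied, two rows coincide and the determinant vanishes: this is the
    -- exclusion rule.
    by_cases hj : j ∈ A
    · obtain ⟨r', hr'⟩ : j ∈ Set.range a := by rw [ha, Finset.range_orderEmbOfFin]; exact hj
      have hrr : r' ≠ r := by rintro rfl; exact hne (hr.symm.trans hr')
      rw [if_neg]
      · refine Matrix.det_zero_of_row_eq hrr ?_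
        ext q
        rw [submatrix_apply, submatrix_apply, Function.update_of_ne hrr, Function.update_self, hr']
      · rintro ⟨h1, h2, rfl⟩
        simp [hne.symm] at hj
    · have hA' : (insert j (A.erase i)).card = A.card := by
        rw [Finset.card_insert_of_notMem (by simp [hj]), Finset.card_erase_add_one hi]
      -- No index lies strictly between the neighbours i and j, so the hop keeps the particles in
      -- order. This is why no sign appears.
      have hmono : StrictMono (Function.update (a : Fin A.card → Fin m) r j) := by
        intro p q hpq
        have hpq' : a p < a q := a.strictMono hpq
        have hjp : ∀ p, a p ≠ j := fun p h => hj (h ▸ Finset.orderEmbOfFin_mem A rfl p)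
        have h1 := hjp p
        have h2 := hjp q
        by_cases hp : p = r
        · subst hp
          have hq : q ≠ p := hpq.ne'
          rw [Function.update_self, Function.update_of_ne hq]
          rw [hr] at hpq'
          rw [Fin.lt_def] at hpq' ⊢
          rw [Ne, Fin.ext_iff] at h2
          omega
        · rw [Function.update_of_ne hp]
          by_cases hq : q = r
          · subst hq
            rw [Function.update_self]
            rw [hr] at hpq'
            rw [Fin.lt_def] at hpq' ⊢
            rw [Ne, Fin.ext_iff] at h1
            omega
          · rw [Function.update_of_ne hq]; exact hpq'
      have := Finset.orderEmbOfFin_unique hA' (f := Function.update (a : Fin A.card → Fin m) r j)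
        (fun p => by
          by_cases hp : p = r
          · subst hp; simp
          · rw [Function.update_of_ne hp]
            refine Finset.mem_insert_of_mem (Finset.mem_erase.mpr
              ⟨fun h => hp (a.injective (h.trans hr.symm)), Finset.orderEmbOfFin_mem A rfl p⟩))
        hmono
      rw [this, hb, submatrix_orderEmb_one_det hA' hB]
      simp only [insert_erase_eq_iff hi hj]
  · rw [if_neg, add_zero]
    · congr 1
      ext p q
      have : i ≠ a p := fun h => hi (h ▸ Finset.orderEmbOfFin_mem A rfl p)
      simp [this]
    · rintro ⟨h1, h2, rfl⟩
      simp at hi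

end Hop

/-! ### The transfer matrix of one column -/

section Column
variable {R : Type*} [CommRing R] {m : ℕ}

/-- `y` is the upper endpoint of a vertical edge of `V`, where edges are given by their lower
endpoints. -/
def IsUpper (V : Finset (Fin m)) (y : Fin m) : Prop := ∃ y' ∈ V, y'.val + 1 = y.val

/-- The local rule at a site: a particle stays, or hops from a source to a neighbouring
non-source along a vertical edge. The arguments say whether the site is a source, whether it is the
upper, resp. lower, endpoint of a vertical edge, and whether it is occupied before and after. -/
def SiteRule (s u v a b : Prop) : Prop :=
  (¬ u ∧ ¬ v ∧ (a ↔ b)) ∨ (Xor u v ∧ ((s ∧ a ∧ ¬ b) ∨ (¬ s ∧ ¬ a ∧ b)))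

/-- The vertical edges `V` lead from the occupied set `A` to the occupied set `B`. -/
def ColumnRule (src : Fin m → Prop) (A V B : Finset (Fin m)) : Prop :=
  ∀ y, SiteRule (src y) (IsUpper V y) (y ∈ V) (y ∈ A) (y ∈ B)

/-- The sources alternate along the column. -/
def Alternates (src : Fin m → Prop) : Prop :=
  ∀ y y' : Fin m, y.val + 1 = y'.val → (src y' ↔ ¬ src y)

open Classical in
/-- The hops out of the sources along the vertical edges whose lower endpoint is below `k`. -/
noncomputable def hopMatrix (R : Type*) [CommRing R] (src : Fin m → Prop) (k : ℕ) :
    Matrix (Fin m) (Fin m) R := fun i j =>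
  if src i ∧ ((i.val + 1 = j.val ∧ i.val < k) ∨ (j.val + 1 = i.val ∧ j.val < k)) then 1 else 0

lemma hopMatrix_zero (src : Fin m → Prop) : hopMatrix R src 0 = 0 := by
  ext i j; simp [hopMatrix]

lemma hopMatrix_succ_of_le {src : Fin m → Prop} {k : ℕ} (hk : m ≤ k + 1) :
    hopMatrix R src (k + 1) = hopMatrix R src k := by
  ext i j
  have hi := i.isLt
  have hj := j.isLt
  simp only [hopMatrix]
  congr 1
  apply propext
  refine and_congr_right fun _ => ?_
  omega

/-- Hops end at non-sources, whereas the new hop starts at a source, so the product of the two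
hopping terms vanishes. Thus 1 + hops factors into elementary matrices, one per vertical edge. -/
lemma one_add_hopMatrix_succ {src : Fin m → Prop} (hsrc : Alternates src) {k : ℕ}
    {i j : Fin m} (hi : src i)
    (hij : (i.val = k ∧ j.val = k + 1) ∨ (j.val = k ∧ i.val = k + 1)) :
    1 + hopMatrix R src (k + 1) = (1 + hopMatrix R src k) * (1 + Matrix.single i j 1) := by
  have h0 : hopMatrix R src k * Matrix.single i j 1 = 0 := by
    ext a b
    by_cases hb : b = j
    · subst hb
      rw [Matrix.mul_single_apply_same, mul_one, Matrix.zero_apply, hopMatrix, if_neg]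
      rintro ⟨ha, ⟨h, -⟩ | ⟨h, -⟩⟩
      · exact ((hsrc _ _ h).mp hi) ha
      · exact ((hsrc _ _ h).mp ha) hi
    · rw [Matrix.mul_single_apply_of_ne _ _ _ _ _ hb, Matrix.zero_apply]
  rw [add_mul, one_mul, mul_add, h0, mul_one, add_zero, add_assoc, add_comm (single i j 1)]
  congr 1
  ext a b
  simp only [hopMatrix, Matrix.add_apply, Matrix.single_apply]
  by_cases hab : i = a ∧ j = b
  · obtain ⟨rfl, rfl⟩ := hab
    rw [if_pos ⟨hi, by omega⟩, if_neg (by omega), if_pos ⟨rfl, rfl⟩, zero_add]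
  · rw [if_neg hab, add_zero]
    congr 1
    apply propext
    refine and_congr_right fun ha => ?_
    by_cases hab' : j = a ∧ i = b
    · obtain ⟨rfl, rfl⟩ := hab'
      exfalso
      rcases hij with ⟨h1, h2⟩ | ⟨h1, h2⟩
      · exact (hsrc i j (by omega)).mp ha hi
      · exact (hsrc j i (by omega)).mp hi ha
    · simp only [Fin.ext_iff] at hab hab'
      omega

/-- The topmost edge can be used last: undoing its hop in B leaves the rule for the lower edges.
Only the two endpoints of that edge are affected, and there the claim is a truth table. -/
lemma columnRule_insert {src : Fin m → Prop} (hsrc : Alternates src) {A V B : Finset (Fin m)}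
    {κ κ' i j : Fin m} (hκ : κ.val + 1 = κ'.val) (hV : ∀ y ∈ V, y.val < κ.val) (hi : src i)
    (hij : (i = κ ∧ j = κ') ∨ (j = κ ∧ i = κ')) :
    ColumnRule src A (insert κ V) B ↔
      j ∈ B ∧ i ∉ B ∧ ColumnRule src A V (insert i (B.erase j)) := by
  have hne : κ ≠ κ' := by rintro rfl; omega
  have hs := hsrc _ _ hκ
  have hκV : κ ∉ V := fun h => lt_irrefl _ (hV _ h)
  have hκV' : κ' ∉ V := fun h => by have := hV _ h; omega
  have hu : IsUpper (insert κ V) κ ↔ IsUpper V κ := by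
    constructor
    · rintro ⟨y, hy, h⟩
      rcases Finset.mem_insert.mp hy with rfl | hy
      · omega
      · exact ⟨y, hy, h⟩
    · rintro ⟨y, hy, h⟩
      exact ⟨y, Finset.mem_insert_of_mem hy, h⟩
  have hu' : IsUpper (insert κ V) κ' := ⟨κ, by simp, hκ⟩
  have hu'' : ¬ IsUpper V κ' := by
    rintro ⟨y, hy, h⟩
    have := hV _ hy
    omega
  have hother : ∀ y, y ≠ κ → y ≠ κ' →
      (SiteRule (src y) (IsUpper (insert κ V) y) (y ∈ insert κ V) (y ∈ A) (y ∈ B) ↔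
       SiteRule (src y) (IsUpper V y) (y ∈ V) (y ∈ A) (y ∈ insert i (B.erase j))) := by
    intro y h1 h2
    have e1 : IsUpper (insert κ V) y ↔ IsUpper V y := by
      constructor
      · rintro ⟨y', hy, h⟩
        rcases Finset.mem_insert.mp hy with rfl | hy
        · exact absurd (Fin.ext (by omega)) h2
        · exact ⟨y', hy, h⟩
      · rintro ⟨y', hy, h⟩
        exact ⟨y', Finset.mem_insert_of_mem hy, h⟩
    have e2 : y ∈ insert κ V ↔ y ∈ V := by simp [h1]
    have e3 : y ∈ insert i (B.erase j) ↔ y ∈ B := by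
      rcases hij with ⟨rfl, rfl⟩ | ⟨rfl, rfl⟩ <;> simp [h1, h2]
    rw [e1, e2, e3]
  have hsplit : ∀ P : Fin m → Prop, (∀ y, P y) ↔
      P κ ∧ P κ' ∧ ∀ y, y ≠ κ → y ≠ κ' → P y := by
    intro P
    refine ⟨fun h => ⟨h _, h _, fun y _ _ => h y⟩, fun ⟨h1, h2, h3⟩ y => ?_⟩
    by_cases e1 : y = κ
    · rwa [e1]
    · by_cases e2 : y = κ'
      · rwa [e2]
      · exact h3 y e1 e2
  have hκκ : κ' ≠ κ := hne.symm
  unfold ColumnRule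
  rw [hsplit, hsplit (fun y => SiteRule (src y) (IsUpper V y) (y ∈ V) (y ∈ A) _),
    ← and_assoc, ← and_assoc, ← and_assoc, ← and_assoc]
  refine and_congr ?_ (forall_congr' fun y => forall_congr' fun h1 => forall_congr' fun h2 =>
    hother y h1 h2)
  rcases hij with ⟨rfl, rfl⟩ | ⟨rfl, rfl⟩
  · simp only [SiteRule, hu, hu', hu'', Xor, Finset.mem_insert, Finset.mem_erase, hκV, hκV',
      hκκ, hi, hs]
    by_cases h1 : IsUpper V i <;> by_cases h2 : i ∈ A <;> by_cases h3 : i ∈ B <;>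
      by_cases h4 : j ∈ A <;> by_cases h5 : j ∈ B <;> simp [h1, h2, h3, h4, h5, hne]
  · have hs' : ¬ src j := hs.mp hi
    simp only [SiteRule, hu, hu', hu'', Xor, Finset.mem_insert, Finset.mem_erase, hκV, hκV',
      hκκ, hi, hs']
    by_cases h1 : IsUpper V j <;> by_cases h2 : i ∈ A <;> by_cases h3 : i ∈ B <;>
      by_cases h4 : j ∈ A <;> by_cases h5 : j ∈ B <;> simp [h1, h2, h3, h4, h5, hne]

-- Adding edges from the bottom up, the two terms of `compound_one_add_single` account for the edge
-- sets without and with the new edge.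
open Classical in
lemma compound_one_add_hopMatrix_aux {src : Fin m → Prop} (hsrc : Alternates src) (k : ℕ)
    (A B : Finset (Fin m)) :
    compound (1 + hopMatrix R src k) A B =
      ((univ.filter fun V : Finset (Fin m) =>
        (∀ y ∈ V, y.val < k ∧ y.val + 1 < m) ∧ ColumnRule src A V B).card : R) := by
  induction k generalizing B with
  | zero =>
    rw [hopMatrix_zero, add_zero, compound_one, Matrix.one_apply]
    have : ∀ V : Finset (Fin m), ((∀ y ∈ V, y.val < 0 ∧ y.val + 1 < m) ∧ ColumnRule src A V B) ↔
        V = ∅ ∧ A = B := by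
      intro V
      have h1 : (∀ y ∈ V, y.val < 0 ∧ y.val + 1 < m) ↔ V = ∅ := by
        simp [Finset.eq_empty_iff_forall_notMem]
      rw [h1]
      refine and_congr_right ?_
      rintro rfl
      simp [ColumnRule, SiteRule, IsUpper, Xor, Finset.ext_iff]
    simp only [this]
    split_ifs with h <;> simp [h, Finset.filter_eq']
  | succ k ih =>
    by_cases hk : k + 1 < m
    · set κ : Fin m := ⟨k, by omega⟩ with hκ
      set κ' : Fin m := ⟨k + 1, hk⟩ with hκ'
      obtain ⟨i, j, hi, hij⟩ : ∃ i j, src i ∧ ((i = κ ∧ j = κ') ∨ (j = κ ∧ i = κ')) := by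
        by_cases h : src κ
        · exact ⟨κ, κ', h, .inl ⟨rfl, rfl⟩⟩
        · exact ⟨κ', κ, (hsrc κ κ' rfl).mpr h, .inr ⟨rfl, rfl⟩⟩
      have hij' : (i.val = k ∧ j.val = k + 1) ∨ (j.val = k ∧ i.val = k + 1) := by
        rcases hij with ⟨rfl, rfl⟩ | ⟨rfl, rfl⟩
        · exact .inl ⟨rfl, rfl⟩
        · exact .inr ⟨rfl, rfl⟩
      rw [one_add_hopMatrix_succ hsrc hi hij', compound_mul, Matrix.mul_apply]
      simp only [compound_one_add_single (R := R) (i := i) (j := j) (by omega), mul_add,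
        Finset.sum_add_distrib, mul_ite, mul_one, mul_zero]
      rw [Finset.sum_ite_eq' univ B, if_pos (mem_univ _), ih]
      have hsum : ∑ x : Finset (Fin m), (if j ∈ B ∧ i ∉ B ∧ x = insert i (B.erase j) then
          compound (1 + hopMatrix R src k) A x else 0) =
          ((univ.filter fun V : Finset (Fin m) => (∀ y ∈ V, y.val < k ∧ y.val + 1 < m) ∧
            ColumnRule src A (insert κ V) B).card : R) := by
        by_cases hB : j ∈ B ∧ i ∉ B
        · simp only [hB.1, hB.2, true_and, not_false_eq_true]
          rw [Finset.sum_ite_eq' univ, if_pos (mem_univ _), ih]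
          congr 2
          ext V
          simp only [mem_filter, mem_univ, true_and]
          refine and_congr_right fun hV => ?_
          rw [columnRule_insert hsrc (κ := κ) (κ' := κ') rfl (fun y hy => (hV y hy).1) hi hij]
          simp [hB]
        · rw [Finset.sum_eq_zero (fun x _ => if_neg (by tauto)), Finset.card_eq_zero.mpr]
          · simp
          · refine Finset.filter_eq_empty_iff.mpr fun V _ => ?_
            rintro ⟨hV, hc⟩
            rw [columnRule_insert hsrc (κ := κ) (κ' := κ') rfl (fun y hy => (hV y hy).1) hi hij]
              at hc
            exact hB ⟨hc.1, hc.2.1⟩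
      rw [hsum, ← Nat.cast_add]
      congr 1
      have hκs : ∀ V : Finset (Fin m), (∀ y ∈ V, y.val < k ∧ y.val + 1 < m) → κ ∉ V :=
        fun V hV h => by have := (hV _ h).1; simp [hκ] at this
      rw [← Finset.card_filter_add_card_filter_not (s := univ.filter fun V : Finset (Fin m) =>
        (∀ y ∈ V, y.val < k + 1 ∧ y.val + 1 < m) ∧ ColumnRule src A V B) (fun V => κ ∉ V)]
      have hle : ∀ y : Fin m, y ≠ κ → (y.val < k ↔ y.val < k + 1) := fun y hy => by
        rw [Ne, Fin.ext_iff] at hy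
        simp only [hκ] at hy
        omega
      congr 1
      · congr 1
        ext V
        simp only [mem_filter, mem_univ, true_and]
        constructor
        · rintro ⟨hV, hc⟩
          exact ⟨⟨fun y hy => ⟨by have := (hV y hy).1; omega, (hV y hy).2⟩, hc⟩, hκs V hV⟩
        · rintro ⟨⟨hV, hc⟩, hn⟩
          exact ⟨fun y hy => ⟨(hle y (fun h => hn (h ▸ hy))).mpr (hV y hy).1, (hV y hy).2⟩, hc⟩
      · refine Finset.card_bij (fun V _ => insert κ V) ?_ ?_ ?_
        · intro V hV
          simp only [mem_filter, mem_univ, true_and] at hV ⊢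
          refine ⟨⟨fun y hy => ?_, hV.2⟩, by simp⟩
          rcases Finset.mem_insert.mp hy with rfl | hy
          · exact ⟨by simp [hκ], hk⟩
          · exact ⟨by have := (hV.1 y hy).1; omega, (hV.1 y hy).2⟩
        · intro V hV W hW h
          simp only [mem_filter, mem_univ, true_and] at hV hW
          rw [← Finset.erase_insert (hκs V hV.1), h, Finset.erase_insert (hκs W hW.1)]
        · intro W hW
          simp only [mem_filter, mem_univ, true_and, not_not] at hW
          refine ⟨W.erase κ, ?_, Finset.insert_erase hW.2⟩
          simp only [mem_filter, mem_univ, true_and]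
          refine ⟨fun y hy => ?_, by rw [Finset.insert_erase hW.2]; exact hW.1.2⟩
          obtain ⟨h1, h2⟩ := Finset.mem_erase.mp hy
          exact ⟨(hle y h1).mpr (hW.1.1 y h2).1, (hW.1.1 y h2).2⟩
    -- The top site is not the lower endpoint of any edge, so from here on nothing is added.
    · rw [hopMatrix_succ_of_le (by omega), ih]
      congr 2
      ext V
      simp only [mem_filter, mem_univ, true_and]
      refine and_congr_left fun _ => forall₂_congr fun y _ => ?_
      omega

open Classical in
/-- The compound of one plus the hopping matrix counts the sets of vertical edges that lead from
one occupied set to another. -/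
theorem compound_one_add_hopMatrix {src : Fin m → Prop} (hsrc : Alternates src)
    (A B : Finset (Fin m)) :
    compound (1 + hopMatrix R src m) A B =
      ((univ.filter fun V : Finset (Fin m) =>
        (∀ y ∈ V, y.val + 1 < m) ∧ ColumnRule src A V B).card : R) := by
  rw [compound_one_add_hopMatrix_aux hsrc]
  simp

end Column

/-! ### Closed paths and traces of matrix products -/

section Cycle
variable {R : Type*} [CommRing R] {S : Type*} [Fintype S] [DecidableEq S]

/-- The entries of a product of matrices as sums over paths. -/
lemma list_prod_apply_eq_sum_paths (T : ℕ → Matrix S S R) (L : ℕ) (a b : S) :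
    ((List.range L).map T).prod a b = ∑ p : Fin (L + 1) → S,
      if p 0 = a ∧ p (Fin.last L) = b then ∏ i : Fin L, T i (p i.castSucc) (p i.succ) else 0 := by
  induction L generalizing b with
  | zero =>
    rw [← (Equiv.funUnique (Fin 1) S).symm.sum_comp]
    simp only [List.range_zero, List.map_nil, List.prod_nil, Matrix.one_apply, Fin.last_zero,
      Finset.univ_eq_empty, Finset.prod_empty, Equiv.funUnique_symm_apply, uniqueElim_const]
    rw [Finset.sum_eq_single a]
    · simp
    · intro c _ hc; simp [hc]
    · simp
  | succ L ih =>
    rw [List.range_succ, List.map_append, List.prod_append, Matrix.mul_apply]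
    rw [← (Fin.snocEquiv (fun _ : Fin (L + 2) => S)).sum_comp, Fintype.sum_prod_type,
      Finset.sum_comm]
    simp only [ih, Finset.sum_mul]
    rw [Finset.sum_comm]
    refine Finset.sum_congr rfl fun p _ => ?_
    simp only [List.map_cons, List.map_nil, List.prod_singleton]
    rw [Finset.sum_eq_single (p (Fin.last L)), Finset.sum_eq_single b]
    · have h0 : (Fin.snoc p b : Fin (L + 2) → S) 0 = p 0 := by
        rw [← Fin.castSucc_zero, Fin.snoc_castSucc]
      simp only [Fin.snocEquiv_apply, Fin.snoc_last, h0, and_true, Fin.prod_univ_castSucc]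
      by_cases h : p 0 = a
      · simp only [h, if_true]
        congr 1
        · refine Finset.prod_congr rfl fun i _ => ?_
          rw [Fin.snoc_castSucc, ← Fin.castSucc_succ, Fin.snoc_castSucc]
          rfl
        · rw [Fin.snoc_castSucc, Fin.succ_last, Fin.snoc_last]
          simp
      · simp [h]
    · intro c _ hc; simp [hc]
    · simp
    · intro c _ hc; simp [hc.symm]
    · simp

/-- The trace of a product of matrices as a sum over closed paths. -/
lemma sum_closed_paths {N : ℕ} [NeZero N] (T : ℕ → Matrix S S R) (D : S → R) :
    ∑ A : ZMod N → S, D (A 0) * ∏ x : ZMod N, T x.val (A x) (A (x + 1)) =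
      ∑ a, D a * ((List.range N).map T).prod a a := by
  obtain _ | L := N
  · exact absurd rfl (NeZero.ne 0)
  rw [List.range_succ, List.map_append, List.prod_append]
  simp only [List.map_cons, List.map_nil, List.prod_singleton, Matrix.mul_apply,
    list_prod_apply_eq_sum_paths, Finset.mul_sum, Finset.sum_mul]
  symm
  calc _ = ∑ a, ∑ p : Fin (L + 1) → S, ∑ b, (D a * ((if p 0 = a ∧ p (Fin.last L) = b then
        ∏ i : Fin L, T i (p i.castSucc) (p i.succ) else 0) * T L b a)) := by
        refine Finset.sum_congr rfl fun a _ => Finset.sum_comm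
    _ = ∑ p : Fin (L + 1) → S, ∑ a, ∑ b, (D a * ((if p 0 = a ∧ p (Fin.last L) = b then
        ∏ i : Fin L, T i (p i.castSucc) (p i.succ) else 0) * T L b a)) := Finset.sum_comm
    _ = _ := by
      refine Finset.sum_congr rfl fun p _ => ?_
      rw [Finset.sum_eq_single (p 0), Finset.sum_eq_single (p (Fin.last L))]
      · rw [if_pos ⟨rfl, rfl⟩]
        refine congrArg (D (p 0) * ·) ?_
        -- The last factor, at x = L, closes the cycle because L + 1 = 0 in `ZMod (L + 1)`.
        refine Eq.trans ?_ (Fin.prod_univ_castSucc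
          (fun x : Fin (L + 1) => T x.val (p x) (p (x + 1)))).symm
        simp
      · intro c _ hc; simp [hc.symm]
      · simp
      · intro c _ hc; simp [hc.symm]
      · simp

lemma list_prod_range_two_mul {M : Type*} [Monoid M] (T : ℕ → M)
    (hT : ∀ k, T (k + 2) = T k) (n : ℕ) :
    ((List.range (2 * n)).map T).prod = (T 0 * T 1) ^ n := by
  have hev : ∀ n, T (2 * n) = T 0 ∧ T (2 * n + 1) = T 1 := by
    intro n
    induction n with
    | zero => exact ⟨rfl, rfl⟩
    | succ n ih => exact ⟨(hT _).trans ih.1, (hT _).trans ih.2⟩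
  induction n with
  | zero => simp
  | succ n ih =>
    rw [show 2 * (n + 1) = 2 * n + 1 + 1 by ring, List.range_succ, List.range_succ]
    simp only [List.map_append, List.map_cons, List.map_nil, List.prod_append,
      List.prod_singleton, ih, (hev n).1, (hev n).2, pow_succ, mul_assoc]

end Cycle

/-! ### The partition function as a determinant -/

section Transfer
variable {R : Type*} [CommRing R] {m : ℕ}

/-- The sources at the `x`-th column cut. -/
def colSrc (m x : ℕ) (y : Fin m) : Prop := Odd (x + y.val)

lemma alternates_colSrc (m x : ℕ) : Alternates (colSrc m x) := by
  intro y y' h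
  simp only [colSrc, ← h, ← add_assoc, Nat.odd_add_one]

lemma colSrc_add_two (m x : ℕ) : colSrc m (x + 2) = colSrc m x := by
  funext y
  simp only [colSrc, eq_iff_iff]
  rw [show x + 2 + y.val = x + y.val + 1 + 1 by ring, Nat.odd_add_one, Nat.odd_add_one, not_not]

/-- The one-particle transfer matrix of two consecutive columns. -/
noncomputable def transfer (R : Type*) [CommRing R] (m : ℕ) : Matrix (Fin m) (Fin m) R :=
  (1 + hopMatrix R (colSrc m 0) m) * (1 + hopMatrix R (colSrc m 1) m)

lemma compound_list_prod (l : List (Matrix (Fin m) (Fin m) R)) :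
    compound l.prod = (l.map compound).prod := by
  induction l with
  | nil => simp [compound_one]
  | cons a l ih => simp [compound_mul, ih]

open Classical in
/-- Closed sequences of occupied sets with connecting vertical edges, counted by a
determinant. -/
theorem sum_pow_card_closed {n : ℕ} [NeZero (2 * n)] (z : R) :
    ∑ A : ZMod (2 * n) → Finset (Fin m), ∑ _V ∈ Fintype.piFinset fun x : ZMod (2 * n) =>
        (univ.filter fun V : Finset (Fin m) =>
          (∀ y ∈ V, y.val + 1 < m) ∧ ColumnRule (colSrc m x.val) (A x) V (A (x + 1))),
      z ^ (A 0).card = (1 + z • transfer R m ^ n).det := by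
  rw [← sum_pow_card_mul_compound]
  have hT : ((List.range (2 * n)).map fun x => compound (1 + hopMatrix R (colSrc m x) m)).prod =
      compound (transfer R m ^ n) := by
    rw [transfer, ← list_prod_range_two_mul (fun x => 1 + hopMatrix R (colSrc m x) m),
      compound_list_prod, List.map_map]
    · rfl
    · intro k; simp only [colSrc_add_two]
  rw [← hT, ← sum_closed_paths]
  refine Finset.sum_congr rfl fun A _ => ?_
  rw [Finset.sum_const, Fintype.card_piFinset, nsmul_eq_mul, mul_comm, Nat.cast_prod]
  congr 1
  refine Finset.prod_congr rfl fun x _ => ?_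
  rw [compound_one_add_hopMatrix (alternates_colSrc m _)]

end Transfer

/-! ### Diagonalisation of the one-particle matrix by sine waves -/

section Spectrum

lemma det_one_add_smul_pow_of_eigenvectors {m : ℕ} (Q : Matrix (Fin m) (Fin m) ℂ)
    (μ : Fin m → ℂ) (hμ : Function.Injective μ) (v : Fin m → Fin m → ℂ) (hv : ∀ k, v k ≠ 0)
    (hQ : ∀ k, Q *ᵥ v k = μ k • v k) (z : ℂ) (n : ℕ) :
    (1 + z • Q ^ n).det = ∏ k, (1 + z * μ k ^ n) := by
  set P : Matrix (Fin m) (Fin m) ℂ := (Matrix.of v)ᵀ with hP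
  have hli : LinearIndependent ℂ v :=
    Module.End.eigenvectors_linearIndependent' (Matrix.toLin' Q) μ hμ v fun k => by
      rw [Module.End.hasEigenvector_iff, Module.End.mem_eigenspace_iff]
      exact ⟨by simpa using hQ k, hv k⟩
  have hPu : IsUnit P := by
    rw [← Matrix.linearIndependent_cols_iff_isUnit]
    exact hli
  have hPd : P.det ≠ 0 := ((Matrix.isUnit_iff_isUnit_det P).mp hPu).ne_zero
  have hQP : Q * P = P * diagonal μ := by
    ext i k
    have := congrFun (hQ k) i
    rw [Matrix.mul_diagonal]
    simpa [Matrix.mul_apply, Matrix.mulVec, dotProduct, hP, mul_comm] using this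
  have hQnP : Q ^ n * P = P * diagonal (fun k => μ k ^ n) := by
    induction n with
    | zero => simp
    | succ n ih =>
      rw [pow_succ, mul_assoc, hQP, ← mul_assoc, ih, mul_assoc, diagonal_mul_diagonal]
      simp [pow_succ]
  have h : (1 + z • Q ^ n) * P = P * diagonal (fun k => 1 + z * μ k ^ n) := by
    rw [add_mul, one_mul, smul_mul_assoc, hQnP]
    ext i k
    simp [Matrix.mul_diagonal]
    ring
  have := congrArg Matrix.det h
  rw [Matrix.det_mul, Matrix.det_mul, Matrix.det_diagonal, mul_comm] at this
  exact mul_left_cancel₀ hPd this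

/-- Heights are shifted to 1, …, m; the zeros of f at 0 and m + 1 are the Dirichlet conditions that
make the neighbour sum uniform at both ends. -/
lemma hopMatrix_mulVec {m : ℕ} (src : Fin m → Prop) [DecidablePred src] (f : ℕ → ℂ) (h0 : f 0 = 0)
    (hm : f (m + 1) = 0) (i : Fin m) :
    (hopMatrix ℂ src m *ᵥ fun j => f (j.val + 1)) i =
      if src i then f i.val + f (i.val + 2) else 0 := by
  have hi := i.isLt
  simp only [Matrix.mulVec, dotProduct, hopMatrix]
  split_ifs with h
  · have h1 : ∑ j : Fin m, (if j.val + 1 = i.val then f (j.val + 1) else 0) = f i.val := by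
      by_cases hz : i.val = 0
      · rw [hz, h0]
        exact Finset.sum_eq_zero fun j _ => if_neg (by omega)
      · rw [Finset.sum_eq_single ⟨i.val - 1, by omega⟩]
        · rw [if_pos (by simp; omega)]
          congr 1
          simp; omega
        · intro j _ hj
          refine if_neg fun h => hj (Fin.ext ?_)
          simp; omega
        · simp
    have h2 : ∑ j : Fin m, (if i.val + 1 = j.val then f (j.val + 1) else 0) = f (i.val + 2) := by
      by_cases hz : i.val + 1 = m
      · rw [show i.val + 2 = m + 1 by omega, hm]
        exact Finset.sum_eq_zero fun j _ => if_neg (by omega)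
      · rw [Finset.sum_eq_single ⟨i.val + 1, by omega⟩]
        · simp
        · intro j _ hj
          refine if_neg fun h => hj (Fin.ext ?_)
          simp; omega
        · simp
    rw [← h1, ← h2, ← Finset.sum_add_distrib]
    refine Finset.sum_congr rfl fun j _ => ?_
    have hj := j.isLt
    by_cases e1 : j.val + 1 = i.val
    · rw [if_pos ⟨h, by omega⟩, if_pos e1, if_neg (by omega)]; simp
    · by_cases e2 : i.val + 1 = j.val
      · rw [if_pos ⟨h, by omega⟩, if_neg e1, if_pos e2]; simp
      · rw [if_neg (by omega), if_neg e1, if_neg e2]; simp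
  · simp [h]

/-- Sine waves with different amplitudes on the even and odd sites. -/
noncomputable def sineWave (θ : ℝ) (a b : ℂ) (j : ℕ) : ℂ :=
  (if Even j then a else b) * (Real.sin (j * θ) : ℝ)

lemma sin_add_sin_neighbours (θ : ℝ) (j : ℕ) :
    Real.sin (j * θ) + Real.sin ((j + 2 : ℕ) * θ) =
      2 * Real.cos θ * Real.sin ((j + 1 : ℕ) * θ) := by
  push_cast
  rw [show (j : ℝ) * θ = (j + 1) * θ - θ by ring, show ((j : ℝ) + 2) * θ = (j + 1) * θ + θ by ring,
    Real.sin_sub, Real.sin_add]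
  ring

/-- The sources of this column are the even shifted heights, so only the even amplitude changes, by
2 cos θ times the odd one. At cut 1 the roles are exchanged. -/
lemma hop_zero_sineWave {m : ℕ} {θ : ℝ} (hθ : Real.sin ((m + 1 : ℕ) * θ) = 0) (a b : ℂ) :
    ((1 + hopMatrix ℂ (colSrc m 0) m) *ᵥ fun j : Fin m => sineWave θ a b (j.val + 1)) =
      fun j : Fin m => sineWave θ (a + (2 * Real.cos θ : ℝ) * b) b (j.val + 1) := by
  classical
  ext i
  rw [Matrix.add_mulVec, Matrix.one_mulVec, Pi.add_apply, hopMatrix_mulVec _ (sineWave θ a b)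
    (by simp [sineWave]) (by simp only [sineWave, hθ]; simp)]
  have hs := congrArg (fun r : ℝ => (r : ℂ)) (sin_add_sin_neighbours θ i.val)
  simp only [Complex.ofReal_add, Complex.ofReal_mul] at hs
  simp only [colSrc, sineWave, zero_add]
  by_cases hi : Odd i.val
  · have e1 : Even (i.val + 1) := by grind
    have e0 : ¬ Even i.val := by grind
    have e2 : ¬ Even (i.val + 2) := by grind
    simp only [hi, e1, e0, e2, if_true, if_false]
    rw [← mul_add, hs]
    push_cast
    ring
  · have e1 : ¬ Even (i.val + 1) := by grind
    simp [hi, e1]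

lemma hop_one_sineWave {m : ℕ} {θ : ℝ} (hθ : Real.sin ((m + 1 : ℕ) * θ) = 0) (a b : ℂ) :
    ((1 + hopMatrix ℂ (colSrc m 1) m) *ᵥ fun j : Fin m => sineWave θ a b (j.val + 1)) =
      fun j : Fin m => sineWave θ a (b + (2 * Real.cos θ : ℝ) * a) (j.val + 1) := by
  classical
  ext i
  rw [Matrix.add_mulVec, Matrix.one_mulVec, Pi.add_apply, hopMatrix_mulVec _ (sineWave θ a b)
    (by simp [sineWave]) (by simp only [sineWave, hθ]; simp)]
  have hs := congrArg (fun r : ℝ => (r : ℂ)) (sin_add_sin_neighbours θ i.val)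
  simp only [Complex.ofReal_add, Complex.ofReal_mul] at hs
  simp only [colSrc, sineWave]
  by_cases hi : Odd i.val
  · have e1 : Even (i.val + 1) := by grind
    have e0 : ¬ Odd (1 + i.val) := by grind
    simp [e1, e0]
  · have e1 : ¬ Even (i.val + 1) := by grind
    have e0 : Even i.val := by grind
    have e2 : Even (i.val + 2) := by grind
    have e3 : Odd (1 + i.val) := by grind
    simp only [e3, e1, e0, e2, if_true, if_false]
    rw [← mul_add, hs]
    push_cast
    ring

/-- The angles of the eigenvectors of the path. -/
noncomputable def pathAngle (m k : ℕ) : ℝ := (k + 1) * Real.pi / (m + 1)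

lemma pathAngle_mem {m k : ℕ} (hk : k < m) : pathAngle m k ∈ Set.Ioo 0 Real.pi := by
  have := Real.pi_pos
  have hkm : (k : ℝ) + 1 < m + 1 := by exact_mod_cast Nat.succ_lt_succ hk
  refine ⟨by unfold pathAngle; positivity, ?_⟩
  rw [pathAngle, div_lt_iff₀ (by positivity)]
  nlinarith

theorem det_transfer (m n : ℕ) (z : ℂ) :
    (1 + z • transfer ℂ m ^ n).det = ∏ k ∈ range m,
      (1 + z * (Real.exp (2 * n * Real.arsinh (Real.cos (pathAngle m k))) : ℝ)) := by
  set s : ℕ → ℝ := fun k => Real.exp (Real.arsinh (Real.cos (pathAngle m k))) with hs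
  have hs0 : ∀ k, 0 < s k := fun k => Real.exp_pos _
  -- This relation makes amplitudes (s, 1) an eigenvector: the two columns send them to (s, s²) and
  -- then to (s³, s²), giving the eigenvalue s².
  have hsl : ∀ k, s k ^ 2 - 1 = 2 * Real.cos (pathAngle m k) * s k := by
    intro k
    have h := Real.sinh_arsinh (Real.cos (pathAngle m k))
    rw [Real.sinh_eq, Real.exp_neg] at h
    have := (hs0 k).ne'
    simp only [hs] at this ⊢
    field_simp at h
    linarith
  rw [det_one_add_smul_pow_of_eigenvectors (transfer ℂ m) (fun k => ((s k.val ^ 2 : ℝ) : ℂ)) ?_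
    (fun k j => sineWave (pathAngle m k.val) (s k.val : ℝ) 1 (j.val + 1)) ?_ ?_]
  · rw [← Fin.prod_univ_eq_prod_range (fun k => (1 + z * (Real.exp (2 * n * Real.arsinh
      (Real.cos (pathAngle m k))) : ℝ))) m]
    refine Finset.prod_congr rfl fun k _ => ?_
    rw [← Complex.ofReal_pow, ← pow_mul, hs]
    simp only
    rw [← Real.exp_nat_mul]
    push_cast
    rfl
  · intro k l hkl
    have h1 : s k.val ^ 2 = s l.val ^ 2 := Complex.ofReal_injective hkl
    have h2 : s k.val = s l.val := by
      rwa [pow_left_inj₀ (hs0 _).le (hs0 _).le two_ne_zero] at h1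
    have h3 := Real.arsinh_injective (Real.exp_injective h2)
    have h4 := Real.injOn_cos (Set.Ioo_subset_Icc_self (pathAngle_mem k.isLt))
      (Set.Ioo_subset_Icc_self (pathAngle_mem l.isLt)) h3
    simp only [pathAngle] at h4
    have := Real.pi_pos
    field_simp at h4
    ext
    exact_mod_cast add_right_cancel h4
  · intro k h
    -- The value at height 1 is sin θ, which is positive on (0, π).
    have hm : 0 < m := by have := k.isLt; omega
    have h0 := congrFun h ⟨0, hm⟩
    have hsin := Real.sin_pos_of_mem_Ioo (pathAngle_mem k.isLt)
    have hne : (Real.sin (pathAngle m k.val) : ℂ) ≠ 0 := by exact_mod_cast hsin.ne'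
    simp [sineWave] at h0
    exact hne (by simpa using h0)
  · intro k
    have hθ : Real.sin ((m + 1 : ℕ) * pathAngle m k.val) = 0 := by
      rw [pathAngle, mul_div_assoc', mul_comm, mul_div_assoc, Nat.cast_add_one, div_self (by positivity), mul_one]
      exact_mod_cast Real.sin_nat_mul_pi (k.val + 1)
    rw [transfer, ← Matrix.mulVec_mulVec, hop_one_sineWave hθ, hop_zero_sineWave hθ]
    have h := hsl k.val
    have e1 : (1 + ((2 * Real.cos (pathAngle m k.val) : ℝ) : ℂ) * (s k.val : ℝ)) =
        ((s k.val ^ 2 : ℝ) : ℂ) := by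
      rw [← Complex.ofReal_mul, ← h]; push_cast; ring
    have e2 : ((s k.val : ℝ) : ℂ) + ((2 * Real.cos (pathAngle m k.val) : ℝ) : ℂ) *
        ((s k.val ^ 2 : ℝ) : ℂ) = ((s k.val ^ 2 : ℝ) : ℂ) * (s k.val : ℝ) := by
      rw [← Complex.ofReal_mul, ← Complex.ofReal_add, ← Complex.ofReal_mul]
      congr 1
      linear_combination (-(s k.val)) * h
    rw [e1, e2]
    ext j
    simp only [sineWave, Pi.smul_apply, smul_eq_mul]
    split_ifs <;> ring

/-- The logarithm of the `i`-th eigenvalue above one. -/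
noncomputable def modeRate (m i : ℕ) : ℝ :=
  Real.arsinh (Real.sin ((2 * i + 1) * Real.pi / (2 * (m + 1))))

/-- The angles of indices p - 1 - i and p + i are symmetric about π/2, so their cosines are opposite
and their eigenvalues inverse to each other. -/
lemma cos_pathAngle_low {p i : ℕ} (hi : i < p) :
    Real.cos (pathAngle (2 * p) (p - 1 - i)) =
      Real.sin ((2 * i + 1) * Real.pi / (2 * ((2 * p : ℕ) + 1))) := by
  rw [← Real.cos_pi_div_two_sub, pathAngle]
  have h : ((p - 1 - i : ℕ) : ℝ) = p - 1 - i := by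
    rw [Nat.sub_sub, Nat.cast_sub (by omega)]; push_cast; ring
  rw [h]
  congr 1
  push_cast
  field_simp
  ring

lemma cos_pathAngle_high (p i : ℕ) :
    Real.cos (pathAngle (2 * p) (p + i)) =
      -Real.sin ((2 * i + 1) * Real.pi / (2 * ((2 * p : ℕ) + 1))) := by
  rw [← Real.cos_add_pi_div_two, pathAngle]
  congr 1
  push_cast
  field_simp
  ring

/-- The partition function in product form: eigenvalues come in inverse pairs. -/
theorem det_transfer_even (p n : ℕ) {z : ℂ} (hz : z ≠ 0) :
    (1 + z • transfer ℂ (2 * p) ^ n).det = z ^ p * ∏ i ∈ range p,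
      (z + z⁻¹ + (2 * Real.cosh (2 * n * modeRate (2 * p) i) : ℝ)) := by
  rw [det_transfer, show range (2 * p) = range (p + p) by rw [two_mul], Finset.prod_range_add,
    ← Finset.prod_range_reflect, ← Finset.prod_mul_distrib, ← Finset.card_range p,
    ← Finset.prod_const, Finset.card_range, ← Finset.prod_mul_distrib]
  refine Finset.prod_congr rfl fun i hi => ?_
  rw [cos_pathAngle_low (Finset.mem_range.mp hi), cos_pathAngle_high, Real.arsinh_neg, ← modeRate,
    mul_neg, Real.cosh_eq, Real.exp_neg]
  -- With e this exponential, the pair contributes (1 + ze)(1 + z/e) = z(z + 1/z + e + 1/e).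
  have h : ((Real.exp (2 * n * modeRate (2 * p) i) : ℝ) : ℂ) ≠ 0 := by
    exact_mod_cast (Real.exp_pos _).ne'
  push_cast at h ⊢
  field_simp
  ring

end Spectrum

/-! ### Convergence of the finite products -/

section Limit

lemma half_le_arsinh {u : ℝ} (h0 : 0 ≤ u) (h1 : u ≤ 1) : u / 2 ≤ Real.arsinh u := by
  have h2 : (1 : ℝ) ≤ √(1 + u ^ 2) := by
    rw [Real.one_le_sqrt]; nlinarith
  calc u / 2 ≤ 2 * u / (u + 2) := by
        rw [div_le_div_iff₀ (by norm_num) (by linarith)]; nlinarith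
    _ ≤ Real.log (1 + u) := Real.le_log_one_add_of_nonneg h0
    _ ≤ Real.arsinh u := by
        rw [Real.arsinh]
        exact Real.log_le_log (by linarith) (by linarith)

/-- Jordan's inequality sin x ≥ 2x/π on [0, π/2], followed by `half_le_arsinh`, gives a bound linear
in i, which is what the domination needs. -/
lemma le_modeRate {p i : ℕ} (hi : i < p) :
    (2 * i + 1) / (2 * ((2 * p : ℕ) + 1)) ≤ modeRate (2 * p) i := by
  have hpi := Real.pi_pos
  have hip : (i : ℝ) + 1 ≤ p := by exact_mod_cast hi
  have hx : (2 * (i : ℝ) + 1) * Real.pi / (2 * ((2 * p : ℕ) + 1)) ≤ Real.pi / 2 := by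
    rw [div_le_div_iff₀ (by positivity) (by norm_num)]
    push_cast
    nlinarith
  have hs := Real.mul_le_sin (x := (2 * (i : ℝ) + 1) * Real.pi / (2 * ((2 * p : ℕ) + 1)))
    (by positivity) hx
  rw [modeRate]
  refine le_trans ?_ (half_le_arsinh (le_trans (by positivity) hs) (Real.sin_le_one _))
  refine le_trans (le_of_eq ?_) (div_le_div_of_nonneg_right hs (by norm_num))
  field_simp

/-- The function arsinh ∘ sin has derivative 1 at 0, so the rate is asymptotic to its argument (2i +
1)π/(2(m + 1)). -/
lemma tendsto_mul_modeRate {τ : ℝ} {n m : ℕ → ℕ} (hm : Tendsto m atTop atTop)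
    (hratio : Tendsto (fun N => (n N : ℝ) / (m N : ℝ)) atTop (𝓝 τ)) (i : ℕ) :
    Tendsto (fun N => 2 * n N * modeRate (m N) i) atTop
      (𝓝 (Real.pi * τ * (2 * i + 1 : ℕ))) := by
  have hpi := Real.pi_pos
  have hmR : Tendsto (fun N => (m N : ℝ)) atTop atTop := tendsto_natCast_atTop_atTop.comp hm
  have hm1 : Tendsto (fun N => (m N : ℝ) + 1) atTop atTop :=
    tendsto_atTop_add_const_right _ _ hmR
  set x : ℕ → ℝ := fun N => (2 * i + 1) * Real.pi / (2 * ((m N : ℝ) + 1)) with hx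
  have hx0 : ∀ N, x N ≠ 0 := fun N => by simp only [hx]; positivity
  have hxt : Tendsto x atTop (𝓝[≠] 0) := by
    refine tendsto_nhdsWithin_iff.mpr ⟨?_, Eventually.of_forall hx0⟩
    exact Tendsto.div_atTop tendsto_const_nhds (hm1.const_mul_atTop (by norm_num))
  have hd : HasDerivAt (fun t => Real.arsinh (Real.sin t)) 1 0 := by
    have h1 := (Real.hasDerivAt_arsinh (Real.sin 0)).comp 0 (Real.hasDerivAt_sin 0)
    simpa [Function.comp_def] using h1
  have hslope := hd.tendsto_slope_zero.comp hxt
  have hq : Tendsto (fun N => (m N : ℝ) / ((m N : ℝ) + 1)) atTop (𝓝 1) := by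
    have h2 : Tendsto (fun N => 1 - 1 / ((m N : ℝ) + 1)) atTop (𝓝 (1 - 0)) :=
      tendsto_const_nhds.sub (Tendsto.div_atTop tendsto_const_nhds hm1)
    rw [sub_zero] at h2
    refine h2.congr fun N => ?_
    field_simp
    ring
  have hmain := ((hratio.mul hq).mul hslope).const_mul ((2 * (i : ℝ) + 1) * Real.pi)
  have e : (2 * (i : ℝ) + 1) * Real.pi * (τ * 1 * 1) = Real.pi * τ * (2 * i + 1 : ℕ) := by
    push_cast; ring
  rw [e] at hmain
  refine hmain.congr' ?_
  filter_upwards [hmR.eventually_gt_atTop 0] with N hN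
  simp only [Function.comp_apply, smul_eq_mul, zero_add, Real.sin_zero, Real.arsinh_zero, sub_zero]
  rw [show Real.arsinh (Real.sin (x N)) = modeRate (m N) i from rfl]
  simp only [hx]
  field_simp

lemma limitFactor_eq {q r : ℝ} (hq : q = Real.exp (-r)) (Y : ℂ) (j : ℕ) :
    limitFactor q Y j = 1 + (4 * Y ^ 2 - 4) / ((2 + 2 * Real.cosh (r * j) : ℝ) : ℂ) := by
  have h0 : (0 : ℝ) < q ^ j := by rw [hq]; positivity
  have hc : 2 + 2 * Real.cosh (r * j) = (1 + q ^ j) ^ 2 / q ^ j := by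
    rw [Real.cosh_eq, hq, ← Real.exp_nat_mul, show (j : ℝ) * -r = -(r * j) by ring, Real.exp_neg]
    field_simp
    ring
  rw [hc, limitFactor]
  have h1 : ((q : ℂ) ^ j) ≠ 0 := by exact_mod_cast h0.ne'
  have h2 : (1 + (q : ℂ) ^ j) ≠ 0 := by exact_mod_cast (show (1 + q ^ j : ℝ) ≠ 0 by positivity)
  push_cast
  rw [show 1 + (q : ℂ) ^ (2 * j) + 2 * (q : ℂ) ^ j = (1 + (q : ℂ) ^ j) ^ 2 by ring]
  field_simp
  ring

lemma inv_two_add_two_cosh_le {c b : ℝ} (hb : b ≤ c) : (2 + 2 * Real.cosh c)⁻¹ ≤ Real.exp (-b) := by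
  rw [Real.exp_neg]
  refine inv_anti₀ (Real.exp_pos b) ?_
  have := Real.exp_pos (-c)
  have := Real.exp_le_exp.mpr hb
  rw [Real.cosh_eq]
  linarith

theorem tendsto_prod_modes {τ q : ℝ} (hτ : 0 < τ) (hq : q = Real.exp (-Real.pi * τ))
    {n m p : ℕ → ℕ} (hm : Tendsto m atTop atTop) (hp : ∀ N, m N = 2 * p N)
    (hratio : Tendsto (fun N => (n N : ℝ) / (m N : ℝ)) atTop (𝓝 τ)) (Y : ℂ) :
    Multipliable (fun i : ℕ => limitFactor q Y (2 * i + 1)) ∧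
      Tendsto (fun N => ∏ i ∈ range (p N),
        (1 + (4 * Y ^ 2 - 4) / ((2 + 2 * Real.cosh (2 * n N * modeRate (m N) i) : ℝ) : ℂ))) atTop
        (𝓝 (∏' i : ℕ, limitFactor q Y (2 * i + 1))) := by
  have hpi := Real.pi_pos
  have hmR : Tendsto (fun N => (m N : ℝ)) atTop atTop := tendsto_natCast_atTop_atTop.comp hm
  set K : ℂ := 4 * Y ^ 2 - 4
  set g : ℕ → ℂ := fun i => K / ((2 + 2 * Real.cosh (Real.pi * τ * (2 * i + 1 : ℕ)) : ℝ) : ℂ)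
  have hfac : (fun i : ℕ => limitFactor q Y (2 * i + 1)) = fun i => 1 + g i := by
    funext i
    exact limitFactor_eq (by rw [hq, neg_mul]) Y (2 * i + 1)
  set f : ℕ → ℕ → ℂ := fun N i => if i < p N then
    K / ((2 + 2 * Real.cosh (2 * n N * modeRate (m N) i) : ℝ) : ℂ) else 0
  -- Any exponent growing linearly in i would do; τ/2 leaves room for replacing m by m + 1 and n/m
  -- by its limit.
  set bound : ℕ → ℝ := fun i => ‖K‖ * Real.exp (-(τ / 2)) ^ i
  have hsum : Summable bound := by
    refine Summable.mul_left _ (summable_geometric_of_lt_one (Real.exp_pos _).le ?_)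
    rw [Real.exp_lt_one_iff]; linarith
  have hnorm : ∀ c : ℝ, ∀ i : ℕ, τ / 2 * i ≤ c →
      ‖K / ((2 + 2 * Real.cosh c : ℝ) : ℂ)‖ ≤ bound i := by
    intro c i hc
    have hcp := Real.cosh_pos c
    rw [norm_div, Complex.norm_real, Real.norm_of_nonneg (by positivity), div_eq_mul_inv]
    refine mul_le_mul_of_nonneg_left ?_ (norm_nonneg _)
    refine (inv_two_add_two_cosh_le hc).trans (le_of_eq ?_)
    rw [← Real.exp_nat_mul]; congr 1; ring
  have hg : ∀ i, ‖g i‖ ≤ bound i := fun i => hnorm _ i (by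
    push_cast
    have h3 := Real.pi_gt_three
    have hi : (0 : ℝ) ≤ i := Nat.cast_nonneg i
    nlinarith [mul_nonneg hτ.le hi, mul_nonneg (mul_nonneg hτ.le hi) (by linarith : 0 ≤ Real.pi - 3),
      mul_pos hτ hpi])
  have hab : ∀ i, Tendsto (fun N => f N i) atTop (𝓝 (g i)) := by
    intro i
    have ht := tendsto_mul_modeRate hm hratio i
    have h1 : Tendsto (fun N => K / ((2 + 2 * Real.cosh (2 * n N * modeRate (m N) i) : ℝ) : ℂ))
        atTop (𝓝 (g i)) := by
      refine Tendsto.div tendsto_const_nhds ?_ ?_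
      · exact (Complex.continuous_ofReal.tendsto _).comp
          (((Real.continuous_cosh.tendsto _).comp ht).const_mul 2 |>.const_add 2)
      · have := Real.cosh_pos (Real.pi * τ * (2 * i + 1 : ℕ))
        exact_mod_cast (by positivity : (2 + 2 * Real.cosh (Real.pi * τ * (2 * i + 1 : ℕ))) ≠ 0)
    refine h1.congr' ?_
    filter_upwards [hm.eventually_gt_atTop (2 * i)] with N hN
    have : i < p N := by rw [hp N] at hN; omega
    simp only [f, if_pos this]
  have hbd : ∀ᶠ N in atTop, ∀ i, ‖f N i‖ ≤ bound i := by
    -- For m ≥ 2 one has 3m/4 ≥ (m + 1)/2, so n > 3τm/4 gives n ≥ τ(m + 1)/2.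
    filter_upwards [hratio.eventually (lt_mem_nhds (show τ * (3 / 4) < τ by linarith)),
      hmR.eventually_ge_atTop 2] with N hN hN2 i
    simp only [f]
    split_ifs with hi
    · apply hnorm
      have hm0 : (0 : ℝ) < m N := by linarith
      rw [lt_div_iff₀ hm0] at hN
      have h1 : τ / 2 * (m N + 1) ≤ n N := by nlinarith
      have h2 := le_modeRate hi
      rw [← hp N] at h2
      have hi0 : (0 : ℝ) ≤ i := Nat.cast_nonneg i
      have hn0 : (0 : ℝ) ≤ n N := Nat.cast_nonneg _
      calc τ / 2 * i ≤ τ / 2 * (m N + 1) * ((2 * i + 1) / (m N + 1)) := by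
            rw [mul_assoc, mul_div_cancel₀ _ (by positivity)]
            nlinarith
        _ ≤ n N * ((2 * i + 1) / (m N + 1)) := by gcongr
        _ = 2 * n N * ((2 * i + 1) / (2 * (m N + 1))) := by field_simp
        _ ≤ _ := by gcongr
    · simp only [norm_zero, bound]; positivity
  constructor
  · rw [hfac]
    exact multipliable_one_add_of_summable (hsum.of_nonneg_of_le (fun _ => norm_nonneg _) hg)
  · rw [hfac]
    refine (tendsto_tprod_one_add_of_dominated_convergence hsum hab hbd).congr fun N => ?_
    rw [tprod_eq_prod (s := range (p N))]
    · refine Finset.prod_congr rfl fun i hi => ?_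
      simp only [f, if_pos (Finset.mem_range.mp hi)]
    · intro i hi
      simp only [f, if_neg (fun h => hi (Finset.mem_range.mpr h)), add_zero]

end Limit

/-! ### Dimer configurations as particle trajectories -/

section Encoding
variable {n m : ℕ}

lemma cylinder_adj {a b : ZMod (2 * n) × Fin m} (hn : 2 ≤ n) : (cylinder n m).Adj a b ↔
    ((b.1 = a.1 + 1 ∨ a.1 = b.1 + 1) ∧ a.2 = b.2) ∨
      ((a.2.val + 1 = b.2.val ∨ b.2.val + 1 = a.2.val) ∧ a.1 = b.1) := by
  have : Fact (1 < 2 * n) := ⟨by omega⟩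
  have h1 : (1 : ZMod (2 * n)) ≠ 0 := one_ne_zero
  rw [cylinder, SimpleGraph.boxProd_adj, SimpleGraph.pathGraph_adj, SimpleGraph.circulantGraph_adj]
  simp only [Set.mem_singleton_iff, sub_eq_iff_eq_add, add_comm (1 : ZMod (2 * n))]
  have h : a.1 ≠ b.1 ∧ (a.1 = b.1 + 1 ∨ b.1 = a.1 + 1) ↔ (b.1 = a.1 + 1 ∨ a.1 = b.1 + 1) := by
    constructor
    · tauto
    · rintro (h | h)
      · exact ⟨fun e => h1 (by rw [e] at h; simpa using h.symm), .inr h⟩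
      · exact ⟨fun e => h1 (by rw [e] at h; simpa using h.symm), .inl h⟩
  rw [h]

/-- This needs n ≥ 2: on a circle of length two the left and right neighbours coincide. -/
lemma zmod_add_one_ne_sub_one (hn : 2 ≤ n) (x : ZMod (2 * n)) : x + 1 ≠ x - 1 := by
  intro h
  have h2 : ((2 : ℕ) : ZMod (2 * n)) = 0 := by
    push_cast
    linear_combination h
  rw [ZMod.natCast_eq_zero_iff] at h2
  have := Nat.le_of_dvd (by norm_num) h2
  omega

lemma zmod_add_one_ne (hn : 2 ≤ n) (x : ZMod (2 * n)) : x + 1 ≠ x := by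
  have : Fact (1 < 2 * n) := ⟨by omega⟩
  simp

lemma zmod_sub_one_ne (hn : 2 ≤ n) (x : ZMod (2 * n)) : x - 1 ≠ x := by
  have : Fact (1 < 2 * n) := ⟨by omega⟩
  simp

lemma odd_val_add_one (hn : 2 ≤ n) (x : ZMod (2 * n)) : Odd (x + 1).val ↔ ¬ Odd x.val := by
  have : Fact (1 < 2 * n) := ⟨by omega⟩
  rw [ZMod.val_add, ZMod.val_one, Nat.odd_iff, Nat.odd_iff, Nat.mod_mul_right_mod]
  omega

/-- The edge from `(x, y)` to `(x + 1, y)` is occupied. -/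
def HorizEdge (M : (cylinder n m).Subgraph) (x : ZMod (2 * n)) (y : Fin m) : Prop :=
  M.Adj (x, y) (x + 1, y)

open Classical in
/-- The lower endpoints of the occupied vertical edges in a column. -/
noncomputable def vertEdges (M : (cylinder n m).Subgraph) (x : ZMod (2 * n)) : Finset (Fin m) :=
  univ.filter fun y => ∃ y' : Fin m, y.val + 1 = y'.val ∧ M.Adj (x, y) (x, y')

lemma mem_vertEdges {M : (cylinder n m).Subgraph} {x : ZMod (2 * n)} {y : Fin m} :
    y ∈ vertEdges M x ↔ ∃ y' : Fin m, y.val + 1 = y'.val ∧ M.Adj (x, y) (x, y') := by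
  simp [vertEdges]

lemma isUpper_vertEdges {M : (cylinder n m).Subgraph} {x : ZMod (2 * n)} {y : Fin m} :
    IsUpper (vertEdges M x) y ↔ ∃ y' : Fin m, y'.val + 1 = y.val ∧ M.Adj (x, y) (x, y') := by
  constructor
  · rintro ⟨y', hy', h⟩
    obtain ⟨y'', h1, h2⟩ := mem_vertEdges.mp hy'
    obtain rfl : y'' = y := Fin.ext (by omega)
    exact ⟨y', h, h2.symm⟩
  · rintro ⟨y', h, hadj⟩
    exact ⟨y', mem_vertEdges.mpr ⟨y, h, hadj.symm⟩, h⟩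

/-- Exactly one of four propositions holds. -/
def ExactlyOne (p q r s : Prop) : Prop :=
  (p ∧ ¬ q ∧ ¬ r ∧ ¬ s) ∨ (¬ p ∧ q ∧ ¬ r ∧ ¬ s) ∨ (¬ p ∧ ¬ q ∧ r ∧ ¬ s) ∨ (¬ p ∧ ¬ q ∧ ¬ r ∧ s)

lemma existsUnique_adj_iff (hn : 2 ≤ n) (M : (cylinder n m).Subgraph) (x : ZMod (2 * n))
    (y : Fin m) : (∃! w, M.Adj (x, y) w) ↔
      ExactlyOne (HorizEdge M x y) (HorizEdge M (x - 1) y) (y ∈ vertEdges M x)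
        (IsUpper (vertEdges M x) y) := by
  have d1 := zmod_add_one_ne_sub_one hn x
  have d2 := zmod_add_one_ne hn x
  have d3 := zmod_sub_one_ne hn x
  have h1 : HorizEdge M x y ↔ M.Adj (x, y) (x + 1, y) := Iff.rfl
  have h2 : HorizEdge M (x - 1) y ↔ M.Adj (x, y) (x - 1, y) := by
    rw [HorizEdge, sub_add_cancel, M.adj_comm]
  rw [h1, h2, mem_vertEdges, isUpper_vertEdges]
  have hcase : ∀ w, M.Adj (x, y) w → (w = (x + 1, y)) ∨ (w = (x - 1, y)) ∨
      (∃ y' : Fin m, y.val + 1 = y'.val ∧ w = (x, y')) ∨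
      (∃ y' : Fin m, y'.val + 1 = y.val ∧ w = (x, y')) := by
    rintro ⟨a, b⟩ hw
    rcases (cylinder_adj hn).mp hw.adj_sub with ⟨h | h, h'⟩ | ⟨h | h, h'⟩ <;> simp only at h h'
    · left; rw [h, h']
    · right; left; rw [h, h']; simp
    · right; right; left; exact ⟨b, h, by rw [h']⟩
    · right; right; right; exact ⟨b, h, by rw [h']⟩
  constructor
  · rintro ⟨w, hw, huniq⟩
    have hu : ∀ w₁ w₂, M.Adj (x, y) w₁ → M.Adj (x, y) w₂ → w₁ = w₂ := fun a b ha hb =>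
      (huniq a ha).trans (huniq b hb).symm
    have e12 : ¬ (M.Adj (x, y) (x + 1, y) ∧ M.Adj (x, y) (x - 1, y)) := fun ⟨a, b⟩ =>
      d1 (congrArg Prod.fst (hu _ _ a b))
    have e1 : ∀ y', ¬ (M.Adj (x, y) (x + 1, y) ∧ M.Adj (x, y) (x, y')) := fun y' ⟨a, b⟩ =>
      d2 (congrArg Prod.fst (hu _ _ a b))
    have e2 : ∀ y', ¬ (M.Adj (x, y) (x - 1, y) ∧ M.Adj (x, y) (x, y')) := fun y' ⟨a, b⟩ =>
      d3 (congrArg Prod.fst (hu _ _ a b))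
    have e3 : ∀ y' y'' : Fin m, y.val + 1 = y'.val → y''.val + 1 = y.val →
        ¬ (M.Adj (x, y) (x, y') ∧ M.Adj (x, y) (x, y'')) := fun y' y'' a b ⟨c, d⟩ => by
      have := congrArg (fun p => p.2.val) (hu _ _ c d)
      simp only at this
      omega
    rcases hcase w hw with rfl | rfl | ⟨y', hy, rfl⟩ | ⟨y', hy, rfl⟩
    · exact .inl ⟨hw, fun h => e12 ⟨hw, h⟩, fun ⟨y', _, h⟩ => e1 y' ⟨hw, h⟩,
        fun ⟨y', _, h⟩ => e1 y' ⟨hw, h⟩⟩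
    · exact .inr (.inl ⟨fun h => e12 ⟨h, hw⟩, hw, fun ⟨y', _, h⟩ => e2 y' ⟨hw, h⟩,
        fun ⟨y', _, h⟩ => e2 y' ⟨hw, h⟩⟩)
    · exact .inr (.inr (.inl ⟨fun h => e1 _ ⟨h, hw⟩, fun h => e2 _ ⟨h, hw⟩, ⟨y', hy, hw⟩,
        fun ⟨y'', h, h'⟩ => e3 _ _ hy h ⟨hw, h'⟩⟩))
    · exact .inr (.inr (.inr ⟨fun h => e1 _ ⟨h, hw⟩, fun h => e2 _ ⟨h, hw⟩,
        fun ⟨y'', h, h'⟩ => e3 _ _ h hy ⟨h', hw⟩, ⟨y', hy, hw⟩⟩))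
  · rintro (⟨p, q, r, s⟩ | ⟨p, q, r, s⟩ | ⟨p, q, ⟨y', hy, r⟩, s⟩ | ⟨p, q, r, ⟨y', hy, s⟩⟩)
    · refine ⟨_, p, fun w hw => ?_⟩
      rcases hcase w hw with rfl | rfl | ⟨y', hy, rfl⟩ | ⟨y', hy, rfl⟩
      · rfl
      · exact absurd hw q
      · exact absurd ⟨y', hy, hw⟩ r
      · exact absurd ⟨y', hy, hw⟩ s
    · refine ⟨_, q, fun w hw => ?_⟩
      rcases hcase w hw with rfl | rfl | ⟨y', hy, rfl⟩ | ⟨y', hy, rfl⟩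
      · exact absurd hw p
      · rfl
      · exact absurd ⟨y', hy, hw⟩ r
      · exact absurd ⟨y', hy, hw⟩ s
    · refine ⟨_, r, fun w hw => ?_⟩
      rcases hcase w hw with rfl | rfl | ⟨y'', hy', rfl⟩ | ⟨y'', hy', rfl⟩
      · exact absurd hw p
      · exact absurd hw q
      · rw [show y'' = y' from Fin.ext (by omega)]
      · exact absurd ⟨y'', hy', hw⟩ s
    · refine ⟨_, s, fun w hw => ?_⟩
      rcases hcase w hw with rfl | rfl | ⟨y'', hy', rfl⟩ | ⟨y'', hy', rfl⟩
      · exact absurd hw p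
      · exact absurd hw q
      · exact absurd ⟨y'', hy', hw⟩ r
      · rw [show y'' = y' from Fin.ext (by omega)]

lemma isPerfectMatching_iff_exactlyOne (hn : 2 ≤ n) (M : (cylinder n m).Subgraph) :
    M.IsPerfectMatching ↔ ∀ x y, ExactlyOne (HorizEdge M x y) (HorizEdge M (x - 1) y)
      (y ∈ vertEdges M x) (IsUpper (vertEdges M x) y) := by
  rw [SimpleGraph.Subgraph.isPerfectMatching_iff, Prod.forall]
  exact forall₂_congr fun x y => existsUnique_adj_iff hn M x y

open Classical in
/-- The occupied sites at a column cut: those of the horizontal edges that cross it, with the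
roles of occupied and empty exchanged on the sources. -/
noncomputable def occupied (M : (cylinder n m).Subgraph) (x : ZMod (2 * n)) : Finset (Fin m) :=
  univ.filter fun y => Xor (HorizEdge M x y) (colSrc m x.val y)

lemma mem_occupied {M : (cylinder n m).Subgraph} {x : ZMod (2 * n)} {y : Fin m} :
    y ∈ occupied M x ↔ Xor (HorizEdge M x y) (colSrc m x.val y) := by
  simp [occupied]

lemma colSrc_val_add_one (hn : 2 ≤ n) (x : ZMod (2 * n)) (y : Fin m) :
    colSrc m (x + 1).val y ↔ ¬ colSrc m x.val y := by
  simp only [colSrc, Nat.odd_add, odd_val_add_one hn]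
  tauto

/-- Without a vertical dimer exactly one of h, h' holds, and the exchange on sources, which
alternates between cuts, makes the occupation constant. With a vertical dimer both fail, so a source
goes from occupied to empty and a non-source from empty to occupied. -/
lemma siteRule_iff_exactlyOne (s u v h h' : Prop) :
    SiteRule s u v (Xor h s) (Xor h' (¬ s)) ↔ ExactlyOne h' h v u := by
  simp only [SiteRule, ExactlyOne, Xor]
  by_cases s <;> by_cases u <;> by_cases v <;> by_cases h <;> by_cases h' <;> simp [*]

lemma isPerfectMatching_iff_columnRule (hn : 2 ≤ n) (M : (cylinder n m).Subgraph) :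
    M.IsPerfectMatching ↔ ∀ x : ZMod (2 * n), ColumnRule (colSrc m x.val) (occupied M x)
      (vertEdges M (x + 1)) (occupied M (x + 1)) := by
  -- Column x + 1 lies between the cuts x and x + 1, hence the shift.
  rw [isPerfectMatching_iff_exactlyOne hn, ← (Equiv.addRight (1 : ZMod (2 * n))).forall_congr_right]
  refine forall_congr' fun x => forall_congr' fun y => ?_
  rw [mem_occupied, mem_occupied, colSrc_val_add_one hn, siteRule_iff_exactlyOne]
  simp

/-- The subgraph with given horizontal and vertical edges. -/
def subgraphOfEdges (hn : 2 ≤ n) (h : ZMod (2 * n) → Fin m → Prop)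
    (v : ZMod (2 * n) → Finset (Fin m)) : (cylinder n m).Subgraph where
  verts := Set.univ
  Adj a b := (((b.1 = a.1 + 1 ∧ h a.1 a.2) ∨ (a.1 = b.1 + 1 ∧ h b.1 b.2)) ∧ a.2 = b.2) ∨
    (((a.2.val + 1 = b.2.val ∧ a.2 ∈ v a.1) ∨ (b.2.val + 1 = a.2.val ∧ b.2 ∈ v b.1)) ∧ a.1 = b.1)
  adj_sub {a b} hab := by
    rw [cylinder_adj hn]
    tauto
  edge_vert _ := Set.mem_univ _
  symm := ⟨fun a b hab => by
    rcases hab with ⟨h1, h2⟩ | ⟨h1, h2⟩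
    · exact .inl ⟨h1.symm, h2.symm⟩
    · exact .inr ⟨h1.symm, h2.symm⟩⟩

lemma horizEdge_subgraphOfEdges (hn : 2 ≤ n) (h : ZMod (2 * n) → Fin m → Prop)
    (v : ZMod (2 * n) → Finset (Fin m)) (x : ZMod (2 * n)) (y : Fin m) :
    HorizEdge (subgraphOfEdges hn h v) x y ↔ h x y := by
  have h1 := zmod_add_one_ne hn x
  have h2 : x ≠ x + 1 + 1 := fun e => zmod_add_one_ne_sub_one hn x (by linear_combination -e)
  simp [HorizEdge, subgraphOfEdges, h2]

lemma vertEdges_subgraphOfEdges (hn : 2 ≤ n) (h : ZMod (2 * n) → Fin m → Prop)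
    (v : ZMod (2 * n) → Finset (Fin m)) (x : ZMod (2 * n)) (hv : ∀ y ∈ v x, y.val + 1 < m) :
    vertEdges (subgraphOfEdges hn h v) x = v x := by
  ext y
  have h1 := (zmod_add_one_ne hn x).symm
  rw [mem_vertEdges]
  simp only [subgraphOfEdges, h1, false_and, or_self, and_true, false_or]
  constructor
  · rintro ⟨y', hy, ⟨-, h⟩ | ⟨h, -⟩⟩
    · exact h
    · omega
  · intro hy
    exact ⟨⟨y.val + 1, hv y hy⟩, rfl, .inl ⟨rfl, hy⟩⟩

lemma subgraphOfEdges_self (hn : 2 ≤ n) {M : (cylinder n m).Subgraph}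
    (hM : M.IsPerfectMatching) : subgraphOfEdges hn (HorizEdge M) (vertEdges M) = M := by
  refine SimpleGraph.Subgraph.ext (hM.2.verts_eq_univ).symm ?_
  funext a b
  obtain ⟨x, y⟩ := a
  obtain ⟨x', y'⟩ := b
  simp only [subgraphOfEdges, eq_iff_iff, mem_vertEdges, HorizEdge]
  constructor
  · rintro (⟨⟨rfl, h⟩ | ⟨rfl, h⟩, rfl⟩ | ⟨⟨h, y'', h', h''⟩ | ⟨h, y'', h', h''⟩, rfl⟩)
    · exact h
    · exact h.symm
    · rwa [show y' = y'' from Fin.ext (by omega)]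
    · rw [show y = y'' from Fin.ext (by omega)]; exact h''.symm
  · intro hadj
    rcases (cylinder_adj hn).mp hadj.adj_sub with ⟨h | h, h'⟩ | ⟨h | h, h'⟩ <;>
      simp only at h h' <;> subst h'
    · subst h; exact .inl ⟨.inl ⟨rfl, hadj⟩, rfl⟩
    · subst h; exact .inl ⟨.inr ⟨rfl, hadj.symm⟩, rfl⟩
    · exact .inr ⟨.inl ⟨h, y', h, hadj⟩, rfl⟩
    · exact .inr ⟨.inr ⟨h, y, h, hadj.symm⟩, rfl⟩

lemma vertEdges_bound (M : (cylinder n m).Subgraph) (x : ZMod (2 * n)) :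
    ∀ y ∈ vertEdges M x, y.val + 1 < m := by
  intro y hy
  obtain ⟨y', h, -⟩ := mem_vertEdges.mp hy
  have := y'.isLt
  omega

lemma finite_dimerConfigs (hn : 2 ≤ n) : (dimerConfigs n m).Finite := by
  have : NeZero (2 * n) := ⟨by omega⟩
  exact Set.toFinite _

open Classical in
/-- The dimer partition function of the cylinder with a weight for the occupation of one cut. -/
theorem sum_dimerConfigs_pow_card_occupied {R : Type*} [CommRing R] (hn : 2 ≤ n) (z : R) :
    ∑ M ∈ (finite_dimerConfigs (m := m) hn).toFinset, z ^ (occupied M 0).card =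
      (1 + z • transfer R m ^ n).det := by
  have : NeZero (2 * n) := ⟨by omega⟩
  rw [← sum_pow_card_closed, Finset.sum_sigma']
  have hocc : ∀ (A V : ZMod (2 * n) → Finset (Fin m)) x, occupied (subgraphOfEdges hn
      (fun x y => Xor (y ∈ A x) (colSrc m x.val y)) V) x = A x := by
    intro A V x
    ext y
    rw [mem_occupied, horizEdge_subgraphOfEdges]
    simp only [Xor]
    tauto
  refine Finset.sum_bij' (fun M _ => ⟨occupied M, fun x => vertEdges M (x + 1)⟩)
    (fun p _ => subgraphOfEdges hn (fun x y => Xor (y ∈ p.1 x) (colSrc m x.val y))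
      (fun x => p.2 (x - 1))) ?_ ?_ ?_ ?_ ?_
  · intro M hM
    simp only [Set.Finite.mem_toFinset, dimerConfigs, Set.mem_ofPred_eq] at hM
    simp only [mem_sigma, mem_univ, Fintype.mem_piFinset, mem_filter, true_and]
    exact fun x => ⟨vertEdges_bound M _, (isPerfectMatching_iff_columnRule hn M).mp hM x⟩
  · rintro ⟨A, V⟩ hp
    simp only [mem_sigma, mem_univ, Fintype.mem_piFinset, mem_filter, true_and] at hp
    simp only [Set.Finite.mem_toFinset, dimerConfigs, Set.mem_ofPred_eq]
    rw [isPerfectMatching_iff_columnRule hn]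
    intro x
    rw [hocc, hocc, vertEdges_subgraphOfEdges, add_sub_cancel_right]
    · exact (hp x).2
    · rw [add_sub_cancel_right]; exact (hp x).1
  · intro M hM
    simp only [Set.Finite.mem_toFinset, dimerConfigs, Set.mem_ofPred_eq] at hM
    conv_rhs => rw [← subgraphOfEdges_self hn hM]
    simp only [sub_add_cancel]
    congr 1
    funext x y
    rw [mem_occupied]
    simp only [Xor, eq_iff_iff]
    tauto
  · rintro ⟨A, V⟩ hp
    simp only [mem_sigma, mem_univ, Fintype.mem_piFinset, mem_filter, true_and] at hp
    refine Sigma.ext ?_ (heq_of_eq ?_)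
    · funext x
      exact hocc _ _ x
    · funext x
      simp only
      rw [vertEdges_subgraphOfEdges, add_sub_cancel_right]
      rw [add_sub_cancel_right]; exact (hp x).1
  · intro M _
    rfl

/-- The number of occupied sites is the same at all cuts. -/
lemma card_occupied_add_one (hn : 2 ≤ n) {M : (cylinder n m).Subgraph}
    (hM : M.IsPerfectMatching) (x : ZMod (2 * n)) :
    (occupied M (x + 1)).card = (occupied M x).card := by
  classical
  by_contra h
  -- Conservation comes from the compound: it vanishes between sets of different sizes, but it also
  -- counts edge sets including that of M. Over ℤ a zero count means no such set.
  have h1 := compound_one_add_hopMatrix (R := ℤ) (alternates_colSrc m x.val) (occupied M x)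
    (occupied M (x + 1))
  rw [compound_of_card_ne _ h, eq_comm, Nat.cast_eq_zero, Finset.card_eq_zero,
    Finset.filter_eq_empty_iff] at h1
  exact h1 (mem_univ (vertEdges M (x + 1)))
    ⟨vertEdges_bound M _, (isPerfectMatching_iff_columnRule hn M).mp hM x⟩

end Encoding

/-! ### The two layers and the flux of the fold -/

section Layers
variable {n m : ℕ}

lemma natCast_eq_iff (hn : 2 ≤ n) {a b : ℕ} (ha : a ≤ n) (hb : b ≤ n) :
    ((a : ℕ) : ZMod (2 * n)) = b ↔ a = b := by
  rw [ZMod.natCast_eq_natCast_iff', Nat.mod_eq_of_lt (by omega), Nat.mod_eq_of_lt (by omega)]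

lemma natCast_add_natCast_eq_zero_iff (hn : 2 ≤ n) {a b : ℕ} (ha : a ≤ n) (hb : b ≤ n) :
    ((a : ℕ) : ZMod (2 * n)) + b = 0 ↔ (a = 0 ∧ b = 0) ∨ (a = n ∧ b = n) := by
  rw [← Nat.cast_add, ZMod.natCast_eq_zero_iff]
  constructor
  · rintro ⟨k, hk⟩
    rcases k with _ | _ | k
    · left; omega
    · right; omega
    · exfalso
      have : 2 * n * (k + 1 + 1) = 2 * n * k + 4 * n := by ring
      have h0 : 0 ≤ 2 * n * k := Nat.zero_le _
      omega
  · rintro (⟨rfl, rfl⟩ | ⟨rfl, rfl⟩)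
    · simp
    · exact ⟨1, by ring⟩

lemma layerOne_injective (hn : 2 ≤ n) : Function.Injective (layerOne (n := n) (m := m)) := by
  rintro ⟨x, y⟩ ⟨x', y'⟩ h
  simp only [layerOne, Prod.mk.injEq] at h
  rw [natCast_eq_iff hn (by omega) (by omega)] at h
  exact Prod.ext (Fin.ext h.1) h.2

lemma layerTwo_injective (hn : 2 ≤ n) : Function.Injective (layerTwo (n := n) (m := m)) := by
  rintro ⟨x, y⟩ ⟨x', y'⟩ h
  simp only [layerTwo, Prod.mk.injEq, neg_inj] at h
  rw [natCast_eq_iff hn (by omega) (by omega)] at h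
  exact Prod.ext (Fin.ext h.1) h.2

/-- A vertex on one of the two vertical sides. -/
def OnSide (p : Rect n m) : Prop := p.1 = 0 ∨ p.1 = Fin.last n

lemma layerOne_eq_layerTwo_iff (hn : 2 ≤ n) {p q : Rect n m} :
    layerOne p = layerTwo q ↔ p = q ∧ OnSide p := by
  obtain ⟨x, y⟩ := p
  obtain ⟨x', y'⟩ := q
  simp only [layerOne, layerTwo, OnSide, Prod.mk.injEq, eq_neg_iff_add_eq_zero]
  rw [natCast_add_natCast_eq_zero_iff hn (by omega) (by omega)]
  simp only [Fin.ext_iff, Fin.val_zero, Fin.val_last]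
  omega

lemma layerOne_eq_layerTwo_of_onSide (hn : 2 ≤ n) {p : Rect n m} (hp : OnSide p) :
    layerOne p = layerTwo p := (layerOne_eq_layerTwo_iff hn).mpr ⟨rfl, hp⟩

/-- The reflection exchanging the two layers. -/
def reflect (a : ZMod (2 * n) × Fin m) : ZMod (2 * n) × Fin m := (-a.1, a.2)

@[simp] lemma reflect_reflect (a : ZMod (2 * n) × Fin m) : reflect (reflect a) = a := by
  simp [reflect]

@[simp] lemma reflect_layerOne (p : Rect n m) : reflect (layerOne p) = layerTwo p := rfl

@[simp] lemma reflect_layerTwo (p : Rect n m) : reflect (layerTwo p) = layerOne p := by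
  simp [reflect, layerOne, layerTwo]

lemma cylinder_adj_reflect (hn : 2 ≤ n) {a b : ZMod (2 * n) × Fin m}
    (h : (cylinder n m).Adj a b) : (cylinder n m).Adj (reflect a) (reflect b) := by
  rw [cylinder_adj hn] at h ⊢
  rcases h with ⟨h | h, h'⟩ | ⟨h, h'⟩
  · exact .inl ⟨.inr (by simp [reflect, h]), h'⟩
  · exact .inl ⟨.inl (by simp [reflect, h]), h'⟩
  · exact .inr ⟨h, by simp [reflect, h']⟩

lemma exists_layer (hn : 2 ≤ n) (a : ZMod (2 * n) × Fin m) :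
    ∃ p : Rect n m, a = layerOne p ∨ a = layerTwo p := by
  have : NeZero (2 * n) := ⟨by omega⟩
  obtain ⟨x, y⟩ := a
  have hx := ZMod.val_lt x
  by_cases h : x.val ≤ n
  · refine ⟨(⟨x.val, by omega⟩, y), .inl ?_⟩
    simp [layerOne]
  · refine ⟨(⟨2 * n - x.val, by omega⟩, y), .inr ?_⟩
    simp only [layerTwo, Prod.mk.injEq, and_true]
    rw [Nat.cast_sub hx.le]
    simp

/-- Both endpoints of an edge of the cylinder lie in the same layer. -/
lemma exists_layer_of_adj (hn : 2 ≤ n) {a b : ZMod (2 * n) × Fin m}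
    (h : (cylinder n m).Adj a b) : ∃ p q : Rect n m,
      (a = layerOne p ∧ b = layerOne q) ∨ (a = layerTwo p ∧ b = layerTwo q) := by
  have : NeZero (2 * n) := ⟨by omega⟩
  have key : ∀ (x : ZMod (2 * n)) (y : Fin m), ∃ p q : Rect n m,
      ((x, y) = layerOne p ∧ (x + 1, y) = layerOne q) ∨
        ((x, y) = layerTwo p ∧ (x + 1, y) = layerTwo q) := by
    intro x y
    have hx := ZMod.val_lt x
    by_cases h : x.val < n
    · refine ⟨(⟨x.val, by omega⟩, y), (⟨x.val + 1, by omega⟩, y), .inl ?_⟩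
      simp [layerOne]
    · refine ⟨(⟨2 * n - x.val, by omega⟩, y), (⟨2 * n - (x.val + 1), by omega⟩, y), .inr ?_⟩
      simp only [layerTwo, Prod.mk.injEq, and_true]
      rw [Nat.cast_sub hx.le, Nat.cast_sub (by omega)]
      simp
  obtain ⟨x, y⟩ := a
  obtain ⟨x', y'⟩ := b
  rcases (cylinder_adj hn).mp h with ⟨e | e, h'⟩ | ⟨e, h'⟩ <;> simp only at e h' <;> subst h'
  · subst e; exact key x y
  · subst e
    obtain ⟨p, q, h⟩ := key x' y
    exact ⟨q, p, h.imp And.symm And.symm⟩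
  · obtain ⟨⟨i, j⟩, hp | hp⟩ := exists_layer hn (x, y)
    · simp only [layerOne, Prod.mk.injEq] at hp
      exact ⟨(i, y), (i, y'), .inl (by simp [layerOne, hp.1])⟩
    · simp only [layerTwo, Prod.mk.injEq] at hp
      exact ⟨(i, y), (i, y'), .inr (by simp [layerTwo, hp.1])⟩

/-- An edge of the `i`-th layer, seen in the rectangle. -/
def LayerAdj (M : (cylinder n m).Subgraph) (i : Bool) (p q : Rect n m) : Prop :=
  cond i (M.Adj (layerOne p) (layerOne q)) (M.Adj (layerTwo p) (layerTwo q))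

lemma LayerAdj.symm {M : (cylinder n m).Subgraph} {i : Bool} {p q : Rect n m}
    (h : LayerAdj M i p q) : LayerAdj M i q p := by
  cases i
  · exact SimpleGraph.Subgraph.Adj.symm h
  · exact SimpleGraph.Subgraph.Adj.symm h

lemma fold_adj {M : (cylinder n m).Subgraph} {p q : Rect n m} :
    (fold M).Adj p q ↔ ∃ i, LayerAdj M i p q := by
  simp [fold, LayerAdj, or_comm]

lemma LayerAdj.fold_adj {M : (cylinder n m).Subgraph} {i : Bool} {p q : Rect n m}
    (h : LayerAdj M i p q) : (fold M).Adj p q := FoldedCylinder.fold_adj.mpr ⟨i, h⟩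

/-- The bipartite sign. -/
def sgn (p : Rect n m) : ℤ := (-1) ^ (p.1.val + p.2.val)

lemma sgn_eq_one_or (p : Rect n m) : sgn p = 1 ∨ sgn p = -1 := neg_one_pow_eq_or ℤ _

/-- The circle has even length, so parity descends to it; this makes the cylinder bipartite. -/
lemma parity_of_natCast_eq {a b : ℕ} (h : ((a : ℕ) : ZMod (2 * n)) = ((b + 1 : ℕ) : ZMod (2 * n))) :
    (-1 : ℤ) ^ a = -(-1) ^ b := by
  rw [ZMod.natCast_eq_natCast_iff] at h
  have h2 : a % 2 = (b + 1) % 2 := h.of_mul_right n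
  rw [neg_one_pow_eq_pow_mod_two, h2, ← neg_one_pow_eq_pow_mod_two, pow_succ, mul_neg_one]

lemma sgn_of_layerAdj (hn : 2 ≤ n) {M : (cylinder n m).Subgraph} {i : Bool} {p q : Rect n m}
    (h : LayerAdj M i p q) : sgn q = -sgn p := by
  obtain ⟨x, y⟩ := p
  obtain ⟨x', y'⟩ := q
  have hv : ∀ {y y' : Fin m}, (y.val + 1 = y'.val ∨ y'.val + 1 = y.val) →
      (-1 : ℤ) ^ y'.val = -(-1) ^ y.val := by
    rintro y y' (h | h)
    · rw [← h, pow_succ]; ring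
    · rw [← h, pow_succ]; ring
  have hx : ∀ {a b : ℕ}, (-1 : ℤ) ^ a = -(-1) ^ b → (-1 : ℤ) ^ b = -(-1) ^ a := fun h => by
    rw [h]; ring
  simp only [sgn, pow_add]
  cases i
  · rcases (cylinder_adj hn).mp (SimpleGraph.Subgraph.Adj.adj_sub h) with
      ⟨h | h, h'⟩ | ⟨h, h'⟩ <;> simp only [layerTwo] at h h'
    · have e := parity_of_natCast_eq (n := n) (a := x.val) (b := x'.val)
        (by push_cast; linear_combination h)
      rw [h', hx e]; ring
    · have e := parity_of_natCast_eq (n := n) (a := x'.val) (b := x.val)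
        (by push_cast; linear_combination h)
      rw [h', e]; ring
    · rw [neg_inj, natCast_eq_iff hn (by omega) (by omega)] at h'
      rw [h', hv h]; ring
  · rcases (cylinder_adj hn).mp (SimpleGraph.Subgraph.Adj.adj_sub h) with
      ⟨h | h, h'⟩ | ⟨h, h'⟩ <;> simp only [layerOne] at h h'
    · have e := parity_of_natCast_eq (n := n) (a := x'.val) (b := x.val)
        (by push_cast; linear_combination h)
      rw [h', e]; ring
    · have e := parity_of_natCast_eq (n := n) (a := x.val) (b := x'.val)
        (by push_cast; linear_combination h)
      rw [h', hx e]; ring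
    · rw [natCast_eq_iff hn (by omega) (by omega)] at h'
      rw [h', hv h]; ring

lemma layerAdj_unique (hn : 2 ≤ n) {M : (cylinder n m).Subgraph} (hM : M.IsPerfectMatching)
    {i : Bool} {p q q' : Rect n m} (h : LayerAdj M i p q) (h' : LayerAdj M i p q') : q = q' := by
  rw [SimpleGraph.Subgraph.isPerfectMatching_iff] at hM
  cases i
  · exact layerTwo_injective hn ((hM _).unique h h')
  · exact layerOne_injective hn ((hM _).unique h h')

/-- Over a side the two layers share the vertex, hence its only dimer. A dimer seen in both layers
has both ends in their intersection, so it lies along a side. -/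
lemma layerAdj_unique_of_onSide (hn : 2 ≤ n) {M : (cylinder n m).Subgraph}
    (hM : M.IsPerfectMatching) {i j : Bool} {p q q' : Rect n m} (hp : OnSide p)
    (h : LayerAdj M i p q) (h' : LayerAdj M j p q') : q = q' ∧ (i ≠ j → OnSide q) := by
  by_cases hij : i = j
  · subst hij
    exact ⟨layerAdj_unique hn hM h h', fun h => absurd rfl h⟩
  have key : ∀ {q q'}, LayerAdj M true p q → LayerAdj M false p q' → q = q' ∧ OnSide q := by
    intro q q' h h'
    rw [SimpleGraph.Subgraph.isPerfectMatching_iff] at hM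
    simp only [LayerAdj, cond_false, cond_true] at h h'
    rw [← layerOne_eq_layerTwo_of_onSide hn hp] at h'
    exact (layerOne_eq_layerTwo_iff hn).mp ((hM _).unique h h')
  rcases i with _ | _ <;> rcases j with _ | _
  · exact absurd rfl hij
  · obtain ⟨h1, h2⟩ := key h' h
    exact ⟨h1.symm, fun _ => h1 ▸ h2⟩
  · obtain ⟨h1, h2⟩ := key h h'
    exact ⟨h1, fun _ => h2⟩
  · exact absurd rfl hij

/-- The vertex is matched inside the `i`-th layer. -/
def LayerMatched (M : (cylinder n m).Subgraph) (i : Bool) (p : Rect n m) : Prop :=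
  ∃ q, LayerAdj M i p q

lemma exists_layerMatched (hn : 2 ≤ n) {M : (cylinder n m).Subgraph} (hM : M.IsPerfectMatching)
    (p : Rect n m) : ∃ i, LayerMatched M i p := by
  rw [SimpleGraph.Subgraph.isPerfectMatching_iff] at hM
  obtain ⟨w, hw, -⟩ := hM (layerOne p)
  obtain ⟨a, b, ⟨h1, h2⟩ | ⟨h1, h2⟩⟩ := exists_layer_of_adj hn hw.adj_sub
  · obtain rfl := layerOne_injective hn h1
    exact ⟨true, b, by rw [h2] at hw; exact hw⟩
  · obtain ⟨rfl, -⟩ := (layerOne_eq_layerTwo_iff hn).mp h1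
    exact ⟨false, b, by rw [h1, h2] at hw; exact hw⟩

lemma layerMatched_of_not_onSide (hn : 2 ≤ n) {M : (cylinder n m).Subgraph}
    (hM : M.IsPerfectMatching) {p : Rect n m} (hp : ¬ OnSide p) (i : Bool) :
    LayerMatched M i p := by
  rw [SimpleGraph.Subgraph.isPerfectMatching_iff] at hM
  cases i
  · obtain ⟨w, hw, -⟩ := hM (layerTwo p)
    obtain ⟨a, b, ⟨h1, h2⟩ | ⟨h1, h2⟩⟩ := exists_layer_of_adj hn hw.adj_sub
    · obtain ⟨rfl, h⟩ := (layerOne_eq_layerTwo_iff hn).mp h1.symm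
      exact absurd h hp
    · obtain rfl := layerTwo_injective hn h1
      exact ⟨b, by rw [h2] at hw; exact hw⟩
  · obtain ⟨w, hw, -⟩ := hM (layerOne p)
    obtain ⟨a, b, ⟨h1, h2⟩ | ⟨h1, h2⟩⟩ := exists_layer_of_adj hn hw.adj_sub
    · obtain rfl := layerOne_injective hn h1
      exact ⟨b, by rw [h2] at hw; exact hw⟩
    · exact absurd ((layerOne_eq_layerTwo_iff hn).mp h1).2 hp

open Classical in
/-- The signed flux of the folded configuration out of a vertex. -/
noncomputable def flux (M : (cylinder n m).Subgraph) (p : Rect n m) : ℤ :=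
  sgn p * ((if LayerMatched M true p then 1 else 0) - if LayerMatched M false p then 1 else 0)

lemma flux_of_not_onSide (hn : 2 ≤ n) {M : (cylinder n m).Subgraph} (hM : M.IsPerfectMatching)
    {p : Rect n m} (hp : ¬ OnSide p) : flux M p = 0 := by
  simp [flux, layerMatched_of_not_onSide hn hM hp]

open Classical in
/-- Matched vertices of a layer cancel in pairs. -/
lemma sum_sgn_layerMatched (hn : 2 ≤ n) {M : (cylinder n m).Subgraph} (hM : M.IsPerfectMatching)
    (i : Bool) (c : (fold M).ConnectedComponent) :
    ∑ p : Rect n m, (if (fold M).connectedComponentMk p = c then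
      sgn p * (if LayerMatched M i p then 1 else 0) else 0) = 0 := by
  have h : ∀ p : Rect n m, (if (fold M).connectedComponentMk p = c then
      sgn p * (if LayerMatched M i p then 1 else 0) else 0) =
      ∑ q : Rect n m, if LayerAdj M i p q ∧ (fold M).connectedComponentMk p = c then
        sgn p else 0 := by
    intro p
    split_ifs with h1 h2
    · obtain ⟨q, hq⟩ := h2
      rw [Finset.sum_eq_single q]
      · simp [hq, h1]
      · intro q' _ hne
        exact if_neg fun h => hne (layerAdj_unique hn hM h.1 hq)
      · simp
    · rw [mul_zero]
      exact (Finset.sum_eq_zero fun q _ => if_neg fun h => h2 ⟨q, h.1⟩).symm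
    · exact (Finset.sum_eq_zero fun q _ => if_neg fun h => h1 h.2).symm
  simp only [h]
  set S := ∑ p : Rect n m, ∑ q : Rect n m,
    if LayerAdj M i p q ∧ (fold M).connectedComponentMk p = c then sgn p else 0 with hS
  -- Swapping the ends of an edge stays in the component and reverses the sign.
  have hneg : S = -S := by
    conv_lhs => rw [hS, Finset.sum_comm]
    rw [hS, ← Finset.sum_neg_distrib]
    refine Finset.sum_congr rfl fun p _ => ?_
    rw [← Finset.sum_neg_distrib]
    refine Finset.sum_congr rfl fun q _ => ?_
    by_cases hpq : LayerAdj M i p q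
    · have hc : (fold M).connectedComponentMk q = (fold M).connectedComponentMk p :=
        SimpleGraph.ConnectedComponent.connectedComponentMk_eq_of_adj hpq.symm.fold_adj
      simp only [hpq, hpq.symm, hc, true_and, sgn_of_layerAdj hn hpq]
      split_ifs <;> simp
    · have hqp : ¬ LayerAdj M i q p := fun h => hpq h.symm
      simp [hpq, hqp]
  omega

-- Flux conservation: what a component sends through one side is balanced at the other.
open Classical in
lemma sum_flux_component (hn : 2 ≤ n) {M : (cylinder n m).Subgraph} (hM : M.IsPerfectMatching)
    (c : (fold M).ConnectedComponent) :
    ∑ p : Rect n m, (if (fold M).connectedComponentMk p = c then flux M p else 0) = 0 := by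
  have h := congrArg₂ (· - ·) (sum_sgn_layerMatched hn hM true c)
    (sum_sgn_layerMatched hn hM false c)
  simp only [sub_zero, ← Finset.sum_sub_distrib] at h
  refine Eq.trans (Finset.sum_congr rfl fun p _ => ?_) h
  split_ifs <;> simp [flux, *]

end Layers

/-! ### Flux of a component through the left side -/

section Components

/-- A connected graph of degree at most two has at most two vertices of degree at most one. -/
lemma card_le_two_of_connected {V : Type*} [Fintype V] {G : SimpleGraph V} [DecidableRel G.Adj]
    (hG : G.Connected) (hdeg : ∀ v, G.degree v ≤ 2) (S : Finset V) (hS : ∀ v ∈ S, G.degree v ≤ 1) :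
    S.card ≤ 2 := by
  classical
  have h1 := hG.card_vert_le_card_edgeSet_add_one
  rw [Nat.card_eq_fintype_card, Nat.card_eq_fintype_card, ← SimpleGraph.edgeFinset_card] at h1
  have h2 := G.sum_degrees_eq_twice_card_edges
  -- Together 2|E| + |S| ≤ 2|V| and |V| ≤ |E| + 1 give |S| ≤ 2.
  have h3 : ∑ v, (G.degree v + if v ∈ S then 1 else 0) ≤ ∑ _v : V, 2 := by
    refine Finset.sum_le_sum fun v _ => ?_
    split_ifs with h
    · have := hS v h; omega
    · simpa using hdeg v
  rw [Finset.sum_add_distrib, h2] at h3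
  simp only [Finset.sum_ite_mem, Finset.univ_inter, Finset.sum_const, smul_eq_mul, mul_one,
    Finset.card_univ] at h3
  omega

variable {n m : ℕ}

/-- A component has at most two vertices on the vertical sides. -/
lemma card_onSide_le_two (hn : 2 ≤ n) {M : (cylinder n m).Subgraph} (hM : M.IsPerfectMatching)
    (c : (fold M).ConnectedComponent) (S : Finset (Rect n m))
    (hS : ∀ p ∈ S, OnSide p ∧ (fold M).connectedComponentMk p = c) : S.card ≤ 2 := by
  classical
  have hdeg : ∀ v : c.supp, c.toSimpleGraph.degree v ≤ 2 := by
    intro v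
    rw [← SimpleGraph.card_neighborFinset_eq_degree]
    have hsub : c.toSimpleGraph.neighborFinset v ⊆
        (univ.filter fun w : c.supp => LayerAdj M true v w) ∪
          univ.filter fun w : c.supp => LayerAdj M false v w := by
      intro w hw
      rw [SimpleGraph.mem_neighborFinset] at hw
      obtain ⟨i, hi⟩ := fold_adj.mp (show (fold M).Adj v w from hw)
      cases i <;> simp [hi]
    refine (Finset.card_le_card hsub).trans ((Finset.card_union_le _ _).trans ?_)
    refine Nat.add_le_add (Finset.card_le_one.mpr ?_) (Finset.card_le_one.mpr ?_) <;>
    · intro a ha b hb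
      simp only [mem_filter, mem_univ, true_and] at ha hb
      exact Subtype.ext (layerAdj_unique hn hM ha hb)
  have h := card_le_two_of_connected c.connected_toSimpleGraph hdeg
    (univ.filter fun v : c.supp => v.val ∈ S) ?_
  · refine le_trans (le_of_eq ?_) h
    symm
    refine Finset.card_bij (fun v _ => v.val) (by simp) (fun _ _ _ _ h => Subtype.ext h) ?_
    intro p hp
    exact ⟨⟨p, (hS p hp).2⟩, by simp [hp], rfl⟩
  · intro v hv
    simp only [mem_filter, mem_univ, true_and] at hv
    rw [← SimpleGraph.card_neighborFinset_eq_degree]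
    refine Finset.card_le_one.mpr fun a ha b hb => ?_
    rw [SimpleGraph.mem_neighborFinset] at ha hb
    obtain ⟨i, hi⟩ := fold_adj.mp (show (fold M).Adj v a from ha)
    obtain ⟨j, hj⟩ := fold_adj.mp (show (fold M).Adj v b from hb)
    exact Subtype.ext (layerAdj_unique_of_onSide hn hM (hS v hv).1 hi hj).1

open Classical in
/-- The flux of a component through the left side. -/
noncomputable def leftFlux (M : (cylinder n m).Subgraph) (F : SimpleGraph (Rect n m))
    (c : F.ConnectedComponent) : ℤ :=
  ∑ y : Fin m, if F.connectedComponentMk (0, y) = c then flux M (0, y) else 0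

/-- The component meets both vertical sides. -/
def Crosses {F : SimpleGraph (Rect n m)} (c : F.ConnectedComponent) : Prop :=
  (∃ y : Fin m, ((0 : Fin (n + 1)), y) ∈ c.supp) ∧ ∃ y : Fin m, (Fin.last n, y) ∈ c.supp

/-- If the component misses the right side, its left flux is its whole flux, which is zero; if it
misses the left side, the sum is empty. -/
lemma leftFlux_of_not_crosses (hn : 2 ≤ n) {M : (cylinder n m).Subgraph}
    (hM : M.IsPerfectMatching) {c : (fold M).ConnectedComponent} (hc : ¬ Crosses c) :
    leftFlux M (fold M) c = 0 := by
  classical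
  by_cases hL : ∃ y : Fin m, ((0 : Fin (n + 1)), y) ∈ c.supp
  · have hR : ∀ y : Fin m, (fold M).connectedComponentMk (Fin.last n, y) ≠ c := fun y h =>
      hc ⟨hL, y, h⟩
    refine Eq.trans ?_ (sum_flux_component hn hM c)
    rw [leftFlux, Fintype.sum_prod_type]
    symm
    rw [Finset.sum_eq_single 0]
    · intro x _ hx
      refine Finset.sum_eq_zero fun y _ => ?_
      by_cases hx' : x = Fin.last n
      · subst hx'; exact if_neg (hR y)
      · rw [flux_of_not_onSide hn hM (by simp [OnSide, hx, hx']), ite_self]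
    · simp
  · push Not at hL
    exact Finset.sum_eq_zero fun y _ => if_neg (hL y)

/-- The component has one vertex on each side. Its left vertex is matched in one layer only: a dimer
in both layers would lead to a side vertex adjacent to it, and the only other one is at horizontal
distance n ≥ 2. -/
lemma leftFlux_of_crosses (hn : 2 ≤ n) {M : (cylinder n m).Subgraph}
    (hM : M.IsPerfectMatching) {c : (fold M).ConnectedComponent} (hc : Crosses c) :
    leftFlux M (fold M) c = 1 ∨ leftFlux M (fold M) c = -1 := by
  classical
  obtain ⟨⟨y, hy⟩, y', hy'⟩ := hc
  rw [SimpleGraph.ConnectedComponent.mem_supp_iff] at hy hy'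
  have h0 : (0 : Fin (n + 1)) ≠ Fin.last n := by
    rw [Ne, Fin.ext_iff]; simp; omega
  have huniq : ∀ q : Rect n m, OnSide q → (fold M).connectedComponentMk q = c →
      q = (0, y) ∨ q = (Fin.last n, y') := by
    intro q hq hqc
    by_contra! hne
    have := card_onSide_le_two hn hM c {q, (0, y), (Fin.last n, y')} (by
      simp only [mem_insert, mem_singleton]
      rintro p (rfl | rfl | rfl)
      · exact ⟨hq, hqc⟩
      · exact ⟨.inl rfl, hy⟩
      · exact ⟨.inr rfl, hy'⟩)
    rw [Finset.card_insert_of_notMem (by simp [hne.1, hne.2]),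
      Finset.card_insert_of_notMem (by simp [h0]), Finset.card_singleton] at this
    omega
  have hf : leftFlux M (fold M) c = flux M (0, y) := by
    rw [leftFlux, Finset.sum_eq_single y, if_pos hy]
    · intro y₂ _ hne
      refine if_neg fun h => ?_
      rcases huniq (0, y₂) (.inl rfl) h with h | h
      · exact hne (congrArg Prod.snd h)
      · exact h0 (congrArg Prod.fst h)
    · simp
  rw [hf]
  have hnot : ¬ (LayerMatched M true (0, y) ∧ LayerMatched M false (0, y)) := by
    rintro ⟨⟨q, hq⟩, ⟨q', hq'⟩⟩
    have hqs := (layerAdj_unique_of_onSide hn hM (.inl rfl) hq hq').2 (by simp)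
    have hqc : (fold M).connectedComponentMk q = c := by
      rw [← hy]
      exact SimpleGraph.ConnectedComponent.connectedComponentMk_eq_of_adj hq.symm.fold_adj
    have hadj := (cylinder_adj hn).mp (SimpleGraph.Subgraph.Adj.adj_sub hq)
    rcases huniq q hqs hqc with rfl | rfl
    · exact SimpleGraph.Subgraph.Adj.ne hq rfl
    · have e1 := natCast_eq_iff hn (a := n) (b := 1) le_rfl (by omega)
      have e2 := natCast_add_natCast_eq_zero_iff hn (a := n) (b := 1) le_rfl (by omega)
      have e3 := natCast_eq_iff hn (a := 0) (b := n) (by omega) le_rfl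
      simp only [layerOne, Fin.val_zero, Fin.val_last] at hadj
      push_cast at e1 e2 e3 hadj
      rcases hadj with ⟨h | h, -⟩ | ⟨-, h⟩
      · rw [zero_add, e1] at h; omega
      · rw [eq_comm, e2] at h; omega
      · rw [e3] at h; omega
  obtain ⟨i, hi⟩ := exists_layerMatched hn hM (0, y)
  have hs := sgn_eq_one_or ((0, y) : Rect n m)
  cases i
  · have : ¬ LayerMatched M true (0, y) := fun h => hnot ⟨h, hi⟩
    simp only [flux, hi, this, if_true, if_false]
    omega
  · have : ¬ LayerMatched M false (0, y) := fun h => hnot ⟨hi, h⟩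
    simp only [flux, hi, this, if_true, if_false]
    omega

end Components

/-! ### Exchange of layers, averaging and the exact finite formula -/

section Flip
variable {n m : ℕ}

/-- The vertices of the cylinder that lie over a set of vertices of the rectangle. -/
def overSet (U : Set (Rect n m)) : Set (ZMod (2 * n) × Fin m) :=
  {a | ∃ p ∈ U, a = layerOne p ∨ a = layerTwo p}

lemma layerOne_mem_over (hn : 2 ≤ n) {U : Set (Rect n m)} {p : Rect n m} :
    layerOne p ∈ overSet U ↔ p ∈ U := by
  constructor
  · rintro ⟨q, hq, h | h⟩
    · rwa [layerOne_injective hn h]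
    · rwa [((layerOne_eq_layerTwo_iff hn).mp h).1]
  · exact fun h => ⟨p, h, .inl rfl⟩

lemma reflect_mem_over {U : Set (Rect n m)} {a : ZMod (2 * n) × Fin m} :
    reflect a ∈ overSet U ↔ a ∈ overSet U := by
  have key : ∀ a, a ∈ overSet U → reflect a ∈ overSet U := by
    rintro _ ⟨p, hp, rfl | rfl⟩
    · exact ⟨p, hp, .inr rfl⟩
    · exact ⟨p, hp, .inl (reflect_layerTwo p)⟩
  exact ⟨fun h => by simpa using key _ h, key a⟩

lemma layerTwo_mem_over (hn : 2 ≤ n) {U : Set (Rect n m)} {p : Rect n m} :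
    layerTwo p ∈ overSet U ↔ p ∈ U := by
  rw [← reflect_layerOne, reflect_mem_over, layerOne_mem_over hn]

/-- Exchange the two layers over `U`. -/
def flip (hn : 2 ≤ n) (U : Set (Rect n m)) (M : (cylinder n m).Subgraph) :
    (cylinder n m).Subgraph where
  verts := Set.univ
  Adj a b := (a ∈ overSet U ∧ b ∈ overSet U ∧ M.Adj (reflect a) (reflect b)) ∨
    (a ∉ overSet U ∧ b ∉ overSet U ∧ M.Adj a b)
  adj_sub := by
    rintro a b (⟨-, -, h⟩ | ⟨-, -, h⟩)
    · simpa using cylinder_adj_reflect hn h.adj_sub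
    · exact h.adj_sub
  edge_vert _ := Set.mem_univ _
  symm := ⟨by
    rintro a b (⟨h1, h2, h⟩ | ⟨h1, h2, h⟩)
    · exact .inl ⟨h2, h1, h.symm⟩
    · exact .inr ⟨h2, h1, h.symm⟩⟩

/-- A union of components of the folded configuration. -/
def FoldClosed (M : (cylinder n m).Subgraph) (U : Set (Rect n m)) : Prop :=
  ∀ p q, (fold M).Adj p q → (p ∈ U ↔ q ∈ U)

lemma FoldClosed.mem_over_iff (hn : 2 ≤ n) {M : (cylinder n m).Subgraph} {U : Set (Rect n m)}
    (hU : FoldClosed M U) {a b : ZMod (2 * n) × Fin m} (h : M.Adj a b) :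
    a ∈ overSet U ↔ b ∈ overSet U := by
  obtain ⟨p, q, ⟨rfl, rfl⟩ | ⟨rfl, rfl⟩⟩ := exists_layer_of_adj hn h.adj_sub
  · rw [layerOne_mem_over hn, layerOne_mem_over hn]
    exact hU p q (LayerAdj.fold_adj (i := true) h)
  · rw [layerTwo_mem_over hn, layerTwo_mem_over hn]
    exact hU p q (LayerAdj.fold_adj (i := false) h)

lemma isPerfectMatching_flip (hn : 2 ≤ n) {M : (cylinder n m).Subgraph} {U : Set (Rect n m)}
    (hU : FoldClosed M U) (hM : M.IsPerfectMatching) : (flip hn U M).IsPerfectMatching := by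
  rw [SimpleGraph.Subgraph.isPerfectMatching_iff] at hM ⊢
  intro a
  by_cases ha : a ∈ overSet U
  · obtain ⟨w, hw, huniq⟩ := hM (reflect a)
    have hwU := (hU.mem_over_iff hn hw).mp (reflect_mem_over.mpr ha)
    refine ⟨reflect w, .inl ⟨ha, reflect_mem_over.mpr hwU, by simpa using hw⟩, ?_⟩
    rintro b (⟨-, -, hb⟩ | ⟨h, -, -⟩)
    · rw [← huniq _ hb, reflect_reflect]
    · exact absurd ha h
  · obtain ⟨w, hw, huniq⟩ := hM a
    have hwU := (hU.mem_over_iff hn hw).not.mp ha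
    refine ⟨w, .inr ⟨ha, hwU, hw⟩, ?_⟩
    rintro b (⟨h, -, -⟩ | ⟨-, -, hb⟩)
    · exact absurd h ha
    · exact huniq _ hb

lemma layerAdj_flip (hn : 2 ≤ n) {M : (cylinder n m).Subgraph} {U : Set (Rect n m)}
    (hU : FoldClosed M U) (i : Bool) (p q : Rect n m) :
    LayerAdj (flip hn U M) i p q ↔ (p ∈ U ∧ LayerAdj M (!i) p q) ∨ (p ∉ U ∧ LayerAdj M i p q) := by
  have h : ∀ j, LayerAdj M j p q → (p ∈ U ↔ q ∈ U) := fun j h => hU p q h.fold_adj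
  have h0 := h false
  have h1 := h true
  cases i <;> simp only [LayerAdj, flip, layerOne_mem_over hn, layerTwo_mem_over hn,
    reflect_layerOne, reflect_layerTwo, cond_true, cond_false, Bool.not_true, Bool.not_false]
      at h0 h1 ⊢ <;> tauto

lemma fold_flip (hn : 2 ≤ n) {M : (cylinder n m).Subgraph} {U : Set (Rect n m)}
    (hU : FoldClosed M U) : fold (flip hn U M) = fold M := by
  ext p q
  rw [fold_adj, fold_adj]
  simp only [layerAdj_flip hn hU, Bool.exists_bool, Bool.not_true, Bool.not_false]
  tauto

lemma flip_flip (hn : 2 ≤ n) {M : (cylinder n m).Subgraph} {U : Set (Rect n m)}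
    (hU : FoldClosed M U) (hM : M.IsPerfectMatching) : flip hn U (flip hn U M) = M := by
  refine SimpleGraph.Subgraph.ext hM.2.verts_eq_univ.symm ?_
  funext a b
  have h : M.Adj a b → (a ∈ overSet U ↔ b ∈ overSet U) := hU.mem_over_iff hn
  simp only [flip, reflect_mem_over, reflect_reflect, eq_iff_iff]
  tauto

lemma flux_flip (hn : 2 ≤ n) {M : (cylinder n m).Subgraph} {U : Set (Rect n m)}
    (hU : FoldClosed M U) (p : Rect n m) [Decidable (p ∈ U)] :
    flux (flip hn U M) p = if p ∈ U then -flux M p else flux M p := by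
  by_cases hp : p ∈ U
  · have h : ∀ i, LayerMatched (flip hn U M) i p ↔ LayerMatched M (!i) p := fun i =>
      exists_congr fun q => by rw [layerAdj_flip hn hU]; tauto
    rw [if_pos hp, flux, flux, propext (h true), propext (h false), Bool.not_true, Bool.not_false]
    ring
  · have h : ∀ i, LayerMatched (flip hn U M) i p ↔ LayerMatched M i p := fun i =>
      exists_congr fun q => by rw [layerAdj_flip hn hU]; tauto
    rw [if_neg hp, flux, flux, propext (h true), propext (h false)]

lemma foldClosed_setOf (M : (cylinder n m).Subgraph)
    (g : Finset (fold M).ConnectedComponent) :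
    FoldClosed M {p | (fold M).connectedComponentMk p ∈ g} := by
  intro p q h
  simp only [Set.mem_ofPred_eq]
  rw [SimpleGraph.ConnectedComponent.connectedComponentMk_eq_of_adj h]

/-- The flux through the left side. -/
noncomputable def totalFlux (M : (cylinder n m).Subgraph) : ℤ := ∑ y : Fin m, flux M (0, y)

lemma zpow_finset_sum {ι : Type*} {w : ℂ} (hw : w ≠ 0) (s : Finset ι) (f : ι → ℤ) :
    w ^ (∑ i ∈ s, f i) = ∏ i ∈ s, w ^ f i := by
  classical
  induction s using Finset.induction_on with
  | empty => simp
  | insert a s ha ih => rw [Finset.sum_insert ha, Finset.prod_insert ha, zpow_add₀ hw, ih]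

-- The graph F is left free so that the flux of a flipped configuration can be split along the
-- components of the original fold.
open Classical in
lemma totalFlux_eq_sum_leftFlux (M : (cylinder n m).Subgraph) (F : SimpleGraph (Rect n m)) :
    totalFlux M = ∑ c : F.ConnectedComponent, leftFlux M F c := by
  simp only [leftFlux]
  rw [Finset.sum_comm]
  simp [totalFlux]

open Classical in
lemma leftFlux_flip (hn : 2 ≤ n) {M : (cylinder n m).Subgraph}
    (g : Finset (fold M).ConnectedComponent) (c : (fold M).ConnectedComponent) :
    leftFlux (flip hn {p | (fold M).connectedComponentMk p ∈ g} M) (fold M) c =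
      if c ∈ g then -leftFlux M (fold M) c else leftFlux M (fold M) c := by
  simp only [leftFlux, flux_flip hn (foldClosed_setOf M g), Set.mem_ofPred_eq]
  split_ifs with hc
  · rw [← Finset.sum_neg_distrib]
    refine Finset.sum_congr rfl fun y _ => ?_
    split_ifs with h1 h2
    · rfl
    · exact absurd (h1 ▸ hc) h2
    · simp
  · refine Finset.sum_congr rfl fun y _ => ?_
    split_ifs with h1 h2
    · exact absurd (h1 ▸ h2) hc
    · rfl
    · rfl

open Classical in
/-- Averaging over the exchanges of layers on the crossing arcs. -/
lemma sum_powerset_zpow_totalFlux_flip (hn : 2 ≤ n) {M : (cylinder n m).Subgraph}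
    (hM : M.IsPerfectMatching) {w : ℂ} (hw : w ≠ 0) :
    ∑ g ∈ (univ.filter fun c : (fold M).ConnectedComponent => Crosses c).powerset,
      w ^ totalFlux (flip hn {p | (fold M).connectedComponentMk p ∈ g} M) =
    (w + w⁻¹) ^ (univ.filter fun c : (fold M).ConnectedComponent => Crosses c).card := by
  set C := univ.filter fun c : (fold M).ConnectedComponent => Crosses c with hC
  have h0 : ∀ c ∉ C, leftFlux M (fold M) c = 0 := fun c hc =>
    leftFlux_of_not_crosses hn hM (by simpa [hC] using hc)
  have h1 : ∀ g ∈ C.powerset,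
      w ^ totalFlux (flip hn {p | (fold M).connectedComponentMk p ∈ g} M) =
        (∏ c ∈ g, w ^ (-leftFlux M (fold M) c)) * ∏ c ∈ C \ g, w ^ leftFlux M (fold M) c := by
    intro g hg
    rw [Finset.mem_powerset] at hg
    rw [totalFlux_eq_sum_leftFlux _ (fold M), zpow_finset_sum hw]
    simp only [leftFlux_flip hn g]
    rw [← Finset.prod_subset (Finset.subset_univ C), ← Finset.prod_sdiff hg, mul_comm]
    · congr 1
      · exact Finset.prod_congr rfl fun c hc => by rw [if_pos hc]
      · exact Finset.prod_congr rfl fun c hc => by rw [if_neg (Finset.mem_sdiff.mp hc).2]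
    · intro c _ hc
      rw [if_neg (fun h => hc (hg h)), h0 c hc, zpow_zero]
  -- The sum over the sets g of flipped arcs is the expansion of a product of factors w^(-f) + w^f,
  -- where f = ±1.
  rw [Finset.sum_congr rfl h1, ← Finset.prod_add, ← Finset.prod_const]
  refine Finset.prod_congr rfl fun c hc => ?_
  rcases leftFlux_of_crosses hn hM (by simpa [hC] using hc : Crosses c) with h | h
  · rw [h, zpow_one, _root_.zpow_neg_one, add_comm]
  · rw [h, neg_neg, zpow_one, _root_.zpow_neg_one]

open Classical in
lemma numCrossing_eq (M : (cylinder n m).Subgraph) : numCrossing M =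
    (univ.filter fun c : (fold M).ConnectedComponent => Crosses c).card := by
  rw [numCrossing, ← Set.ncard_coe_finset]
  congr 1
  ext c
  simp [crossingArcs, Crosses]

/-- The crossing arcs are counted by the flux: each has two equally likely orientations. -/
theorem sum_pow_numCrossing (hn : 2 ≤ n) {w : ℂ} (hw : w ≠ 0) :
    ∑ M ∈ (finite_dimerConfigs (m := m) hn).toFinset, ((w + w⁻¹) / 2) ^ numCrossing M =
      ∑ M ∈ (finite_dimerConfigs (m := m) hn).toFinset, w ^ totalFlux M := by
  classical
  set D := (finite_dimerConfigs (m := m) hn).toFinset with hD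
  have hmem : ∀ M, M ∈ D ↔ M.IsPerfectMatching := fun M => by
    simp [hD, dimerConfigs]
  rw [← Finset.sum_fiberwise D fold, ← Finset.sum_fiberwise D fold]
  refine Finset.sum_congr rfl fun F _ => ?_
  set C := univ.filter fun c : F.ConnectedComponent => Crosses c with hC
  set U : Finset F.ConnectedComponent → Set (Rect n m) := fun g =>
    {p | F.connectedComponentMk p ∈ g} with hU
  have hN : ∀ M ∈ D.filter (fold · = F), numCrossing M = C.card := by
    intro M h
    obtain ⟨-, rfl⟩ := Finset.mem_filter.mp h
    exact numCrossing_eq M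
  have hclosed : ∀ M ∈ D.filter (fold · = F), ∀ g, FoldClosed M (U g) := by
    intro M h g
    obtain ⟨-, rfl⟩ := Finset.mem_filter.mp h
    exact foldClosed_setOf M g
  have hmaps : ∀ g, ∀ M ∈ D.filter (fold · = F), flip hn (U g) M ∈ D.filter (fold · = F) := by
    intro g M h
    have hc := hclosed M h g
    obtain ⟨h1, h2⟩ := Finset.mem_filter.mp h
    rw [hmem] at h1
    rw [Finset.mem_filter, hmem, fold_flip hn hc]
    exact ⟨isPerfectMatching_flip hn hc h1, h2⟩
  have hflip : ∀ g, ∑ M ∈ D.filter (fold · = F), w ^ totalFlux (flip hn (U g) M) =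
      ∑ M ∈ D.filter (fold · = F), w ^ totalFlux M := by
    intro g
    refine Finset.sum_bij' (fun M _ => flip hn (U g) M) (fun M _ => flip hn (U g) M)
      (hmaps g) (hmaps g) ?_ ?_ (fun _ _ => rfl) <;>
    · intro M h
      exact flip_flip hn (hclosed M h g) ((hmem M).mp (Finset.mem_filter.mp h).1)
  have hsum : ∀ M ∈ D.filter (fold · = F),
      ∑ g ∈ C.powerset, w ^ totalFlux (flip hn (U g) M) = (w + w⁻¹) ^ C.card := by
    intro M h
    obtain ⟨h1, rfl⟩ := Finset.mem_filter.mp h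
    exact sum_powerset_zpow_totalFlux_flip hn ((hmem M).mp h1) hw
  have h2 : ((2 : ℂ) ^ C.card) ≠ 0 := pow_ne_zero _ two_ne_zero
  -- Double counting over pairs (g, M): each flip permutes the fibre of F, and for fixed M the sum
  -- over g is already known.
  have hdouble : (2 : ℂ) ^ C.card * ∑ M ∈ D.filter (fold · = F), w ^ totalFlux M =
      ∑ M ∈ D.filter (fold · = F), (w + w⁻¹) ^ C.card := by
    rw [← Finset.sum_congr rfl hsum, Finset.sum_comm, Finset.sum_congr rfl (fun g _ => hflip g),
      Finset.sum_const, Finset.card_powerset, nsmul_eq_mul]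
    push_cast
    rfl
  rw [Finset.sum_congr rfl (fun M h => by rw [hN M h, div_pow]), ← Finset.sum_div, ← hdouble,
    mul_div_cancel_left₀ _ h2]

lemma layerMatched_zero_iff (hn : 2 ≤ n) {M : (cylinder n m).Subgraph} (y : Fin m) :
    (LayerMatched M true (0, y) ↔ HorizEdge M 0 y ∨ y ∈ vertEdges M 0 ∨ IsUpper (vertEdges M 0) y) ∧
    (LayerMatched M false (0, y) ↔
      HorizEdge M (0 - 1) y ∨ y ∈ vertEdges M 0 ∨ IsUpper (vertEdges M 0) y) := by
  have hz1 : (layerOne (0, y) : ZMod (2 * n) × Fin m) = (0, y) := by simp [layerOne]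
  have hz2 : (layerTwo (0, y) : ZMod (2 * n) × Fin m) = (0, y) := by simp [layerTwo]
  have e2 : HorizEdge M (0 - 1) y ↔ M.Adj (0, y) (-1, y) := by
    rw [HorizEdge, sub_add_cancel, M.adj_comm, zero_sub]
  rw [mem_vertEdges, isUpper_vertEdges, e2, HorizEdge, zero_add]
  constructor
  · constructor
    · rintro ⟨⟨x, y'⟩, h⟩
      simp only [LayerAdj, cond_true, hz1] at h
      rcases (cylinder_adj hn).mp h.adj_sub with ⟨e | e, e'⟩ | ⟨e, e'⟩ <;>
        simp only [layerOne] at e e' h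
      · subst e'; rw [e, zero_add] at h; exact .inl h
      · have := natCast_add_natCast_eq_zero_iff hn (a := x.val) (b := 1) (by omega) (by omega)
        rw [Nat.cast_one] at this
        have := this.mp e.symm
        omega
      · rw [← e'] at h
        rcases e with e | e
        · exact .inr (.inl ⟨y', e, h⟩)
        · exact .inr (.inr ⟨y', e, h⟩)
    · rintro (h | ⟨y', -, h⟩ | ⟨y', -, h⟩)
      · refine ⟨(⟨1, by omega⟩, y), ?_⟩
        simp only [LayerAdj, cond_true, hz1]
        simpa [layerOne] using h
      all_goals
        refine ⟨(0, y'), ?_⟩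
        simp only [LayerAdj, cond_true, hz1]
        simpa [layerOne] using h
  · constructor
    · rintro ⟨⟨x, y'⟩, h⟩
      simp only [LayerAdj, cond_false, hz2] at h
      rcases (cylinder_adj hn).mp h.adj_sub with ⟨e | e, e'⟩ | ⟨e, e'⟩ <;>
        simp only [layerTwo] at e e' h
      · have := natCast_add_natCast_eq_zero_iff hn (a := x.val) (b := 1) (by omega) (by omega)
        rw [Nat.cast_one] at this
        have := this.mp (by linear_combination -e)
        omega
      · subst e'
        rw [show -((x.val : ℕ) : ZMod (2 * n)) = -1 by linear_combination -e] at h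
        exact .inl h
      · rw [← e'] at h
        rcases e with e | e
        · exact .inr (.inl ⟨y', e, h⟩)
        · exact .inr (.inr ⟨y', e, h⟩)
    · rintro (h | ⟨y', -, h⟩ | ⟨y', -, h⟩)
      · refine ⟨(⟨1, by omega⟩, y), ?_⟩
        simp only [LayerAdj, cond_false, hz2]
        simpa [layerTwo] using h
      all_goals
        refine ⟨(0, y'), ?_⟩
        simp only [LayerAdj, cond_false, hz2]
        simpa [layerTwo] using h

/-- Site by site, flux plus one is the sum of the occupations at the cuts on both sides of column 0,
and these two cuts carry equally many particles. -/
lemma totalFlux_add (hn : 2 ≤ n) {M : (cylinder n m).Subgraph} (hM : M.IsPerfectMatching) :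
    totalFlux M + m = 2 * (occupied M 0).card := by
  classical
  have h1 := card_occupied_add_one hn hM (0 - 1)
  rw [sub_add_cancel] at h1
  rw [two_mul]
  nth_rewrite 2 [h1]
  rw [occupied, occupied, Finset.card_filter, Finset.card_filter]
  push_cast
  have hm : (m : ℤ) = ∑ _y : Fin m, 1 := by simp
  rw [totalFlux, hm, ← Finset.sum_add_distrib, ← Finset.sum_add_distrib]
  refine Finset.sum_congr rfl fun y _ => ?_
  have hex := (isPerfectMatching_iff_exactlyOne hn M).mp hM 0 y
  have hsrc := colSrc_val_add_one (m := m) hn (0 - 1) y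
  rw [sub_add_cancel] at hsrc
  obtain ⟨e1, e2⟩ := layerMatched_zero_iff hn (M := M) y
  simp only [flux, e1, e2]
  have hs : colSrc m (0 : ZMod (2 * n)).val y ↔ Odd y.val := by simp [colSrc]
  have hs' : colSrc m (0 - 1 : ZMod (2 * n)).val y ↔ ¬ Odd y.val := by rw [← hs, hsrc, not_not]
  have hsg : sgn ((0, y) : Rect n m) = if Odd y.val then -1 else 1 := by
    simp only [sgn, Fin.val_zero, zero_add]
    split_ifs with h
    · exact h.neg_one_pow
    · exact (Nat.not_odd_iff_even.mp h).neg_one_pow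
  rw [hsg]
  simp only [hs, hs', Xor]
  by_cases ho : Odd y.val <;>
    rcases hex with ⟨p, q, r, s⟩ | ⟨p, q, r, s⟩ | ⟨p, q, r, s⟩ | ⟨p, q, r, s⟩ <;>
    simp [ho, p, q, r, s, -zero_sub]

theorem sum_zpow_totalFlux (hn : 2 ≤ n) {p : ℕ} {w : ℂ} (hw : w ≠ 0) :
    ∑ M ∈ (finite_dimerConfigs (m := 2 * p) hn).toFinset, w ^ totalFlux M =
      ∏ i ∈ range p, (w ^ 2 + (w ^ 2)⁻¹ +
        (2 * Real.cosh (2 * n * modeRate (2 * p) i) : ℝ)) := by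
  have hw2 : (w ^ 2) ≠ 0 := pow_ne_zero _ hw
  have hterm : ∀ M ∈ (finite_dimerConfigs (m := 2 * p) hn).toFinset,
      w ^ totalFlux M = ((w ^ 2) ^ p)⁻¹ * (w ^ 2) ^ (occupied M 0).card := by
    intro M hM
    have h := totalFlux_add hn (show M.IsPerfectMatching by simpa [dimerConfigs] using hM)
    have e : totalFlux M = 2 * ((occupied M 0).card : ℤ) - (2 * p : ℕ) := by omega
    rw [e, zpow_sub₀ hw, ← pow_mul, ← pow_mul, zpow_natCast, div_eq_mul_inv, mul_comm]
    norm_cast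
  rw [Finset.sum_congr rfl hterm, ← Finset.mul_sum, sum_dimerConfigs_pow_card_occupied hn,
    det_transfer_even p n hw2, inv_mul_cancel_left₀ (pow_ne_zero _ hw2)]

lemma crossingGenFun_eq (hn : 2 ≤ n) (Y : ℂ) : crossingGenFun n m Y =
    (∑ M ∈ (finite_dimerConfigs (m := m) hn).toFinset, Y ^ numCrossing M) /
      (finite_dimerConfigs (m := m) hn).toFinset.card := by
  classical
  set D := (finite_dimerConfigs (m := m) hn).toFinset with hD
  have hprob : ∀ k, probCrossing n m k = ((D.filter (numCrossing · = k)).card : ℝ) / D.card := by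
    intro k
    rw [probCrossing, ← Set.ncard_coe_finset, ← Set.ncard_coe_finset, Finset.coe_filter, hD]
    simp
  have hsupp : ∀ k ∉ D.image numCrossing, (probCrossing n m k : ℂ) * Y ^ k = 0 := by
    intro k hk
    rw [hprob, Finset.filter_false_of_mem]
    · simp
    · intro M hM h
      exact hk (Finset.mem_image.mpr ⟨M, hM, h⟩)
  rw [crossingGenFun, tsum_eq_sum hsupp, Finset.sum_div,
    ← Finset.sum_fiberwise_of_maps_to (fun M hM => Finset.mem_image_of_mem numCrossing hM)]
  refine Finset.sum_congr rfl fun k _ => ?_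
  rw [hprob, Finset.sum_congr rfl (fun M hM => by rw [(Finset.mem_filter.mp hM).2]),
    Finset.sum_const, nsmul_eq_mul]
  push_cast
  ring

/-- The generating function of the number of crossing arcs on a finite cylinder. -/
theorem crossingGenFun_eq_prod (hn : 2 ≤ n) (p : ℕ) (Y : ℂ) : crossingGenFun n (2 * p) Y =
    ∏ i ∈ range p, (1 + (4 * Y ^ 2 - 4) /
      ((2 + 2 * Real.cosh (2 * n * modeRate (2 * p) i) : ℝ) : ℂ)) := by
  -- Every complex Y is a cosine, hence of the form (w + w⁻¹)/2 with w ≠ 0.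
  obtain ⟨θ, rfl⟩ := Complex.cos_surjective Y
  set w := Complex.exp (θ * Complex.I) with hwdef
  have hw : w ≠ 0 := Complex.exp_ne_zero _
  have hY : Complex.cos θ = (w + w⁻¹) / 2 := by
    rw [Complex.cos, hwdef, ← Complex.exp_neg, neg_mul]
  -- At w = 1 the product counts the configurations. In the quotient, w² + w⁻² = 4Y² - 2.
  have hcard := sum_zpow_totalFlux (p := p) hn (one_ne_zero (α := ℂ))
  simp only [_root_.one_zpow, Finset.sum_const, nsmul_eq_mul, mul_one] at hcard
  rw [crossingGenFun_eq hn, hY, sum_pow_numCrossing hn hw, sum_zpow_totalFlux hn hw, hcard,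
    ← Finset.prod_div_distrib]
  refine Finset.prod_congr rfl fun i _ => ?_
  have hc := Real.cosh_pos (2 * n * modeRate (2 * p) i)
  have hne : ((2 + 2 * Real.cosh (2 * n * modeRate (2 * p) i) : ℝ) : ℂ) ≠ 0 := by
    exact_mod_cast (by positivity)
  have h1 : (1 : ℂ) ^ 2 + (1 ^ 2)⁻¹ + (2 * Real.cosh (2 * n * modeRate (2 * p) i) : ℝ) =
      ((2 + 2 * Real.cosh (2 * n * modeRate (2 * p) i) : ℝ) : ℂ) := by
    push_cast; ring
  rw [h1, eq_comm, one_add_div hne]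
  congr 1
  push_cast
  field_simp
  ring

end Flip
end FoldedCylinder

theorem mainTheorem5 (τ : ℝ) (hτ : 0 < τ) (q : ℝ) (hq : q = Real.exp (-Real.pi * τ))
    (n m : ℕ → ℕ) (hn : Tendsto n atTop atTop) (hm : Tendsto m atTop atTop)
    (hm_even : ∀ i, Even (m i))
    (hratio : Tendsto (fun i => (n i : ℝ) / (m i : ℝ)) atTop (𝓝 τ)) (Y : ℂ) :
    Multipliable (fun i : ℕ => FoldedCylinder.limitFactor q Y (2 * i + 1)) ∧
      Tendsto (fun i => FoldedCylinder.crossingGenFun (n i) (m i) Y) atTop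
        (𝓝 (∏' i : ℕ, FoldedCylinder.limitFactor q Y (2 * i + 1))) := by
  choose p hp using fun i => (hm_even i).two_dvd
  obtain ⟨h1, h2⟩ := FoldedCylinder.tendsto_prod_modes hτ hq hm hp hratio Y
  refine ⟨h1, h2.congr' ?_⟩
  filter_upwards [hn.eventually_ge_atTop 2] with i hi
  rw [hp i, FoldedCylinder.crossingGenFun_eq_prod hi]
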